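/- Let $0<m\le M$, $L,K\ge 0$, $\gamma_1>0$ and $T_0>0$. There is a constant $C$, depending only on $m,M,L,K,\gamma_1,T_0$, such that the following holds for every $T\in(0,T_0]$, with $\Omega_T:=\mathbb R\times(0,T]$. Let $g:\mathbb R\to\mathbb R$ be Lipschitz with constant $L$ and $m\le g\le M$, and let $\theta$ be a real function that is Hölder continuous with exponent $1/2$ and constant $K$ (with respect to $(x,t)$, for the metric $\max(|x-y|,|t-s|)$) on $\mathbb R\times[0,T]$. Let $\mathcal L:=\partial_t-g(\theta(x,t))\partial_{xx}+\gamma_1$, and let $\Gamma(x,t;\xi,\tau)$, $0\le\tau<t\le T$, be the kernel of $\mathcal L$ given by the parametrix method: with $$H^{\xi,\tau}(x-\xi,t-\tau)=\frac{1}{\sqrt{4\pi g(\theta(\xi,\tau))(t-\tau)}}\,e^{-\frac{(x-\xi)^2}{4g(\theta(\xi,\tau))(t-\tau)}},\qquad \mathcal K_0(x,t;\xi,\tau)=-\mathcal L_{(x,t)}H^{\xi,\tau}(x-\xi,t-\tau),$$ $$\mathcal K_{n+1}(x,t;\xi,\tau)=\int_\tau^t\int_{\mathbb R}\mathcal K_0(x,t;y,s)\,\mathcal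 K_n(y,s;\xi,\tau)\,dy\,ds,\qquad \Phi=\sum_{n\ge0}\mathcal K_n,$$ one sets $$\Gamma(x,t;\xi,\tau)=H^{\xi,\tau}(x-\xi,t-\tau)+\int_\tau^t\int_{\mathbb R}H^{y,s}(x-y,t-s)\,\Phi(y,s;\xi,\tau)\,dy\,ds .$$ The integrals defining $\mathcal K_n$ and $\Gamma$ and the series for $\Phi$ converge absolutely for all $x,\xi\in\mathbb R$ and $0\le\tau<t\le T$, and $\Gamma$ is differentiable in $x$ there; write $\Gamma_x$ for its derivative. Let $f\in L^2(\Omega_T)$ be real-valued. Then the integrals $$M_f(x,t):=\int_0^t\int_{\mathbb R}\Gamma(x,t;\xi,\tau)f(\xi,\tau)\,d\xi\,d\tau,\qquad M_{f,x}(x,t):=\int_0^t\int_{\mathbb R}\Gamma_x(x,t;\xi,\tau)f(\xi,\tau)\,d\xi\,d\tau$$ converge absolutely, the first for every and the second for almost every $(x,t)\in\Omega_T$; both are (almost everywhere equal to) measurable functions on $\Omega_T$, and $$\|M_f\|_{L^\infty(\Omega_T)}\le C\,T^{1/4}\|f\|_{L^2(\Omega_T)},\qquad \|M_{f,x}\|_{L^\infty(\Omega_T)}\le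 C\,T^{1/4}\|f\|_{L^\infty((0,T),L^2(\mathbb R))},$$ $$\|M_f\|_{L^2(\Omega_T)}\le C\,T\,\|f\|_{L^2(\Omega_T)},\qquad \|M_{f,x}\|_{L^2(\Omega_T)}\le C\,\sqrt T\,\|f\|_{L^2(\Omega_T)},$$ where the second estimate is void if $\|f\|_{L^\infty((0,T),L^2(\mathbb R))}=\infty$. -/

import Mathlib

open MeasureTheory Set
open scoped ENNReal NNReal

noncomputable section

namespace ParabolicKernel

/-- The heat kernel of `∂ₜ - a ∂ₓₓ` (constant `a > 0`), at position `x` and time `t > 0`. -/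
def heatKernel (a x t : ℝ) : ℝ :=
  (Real.sqrt (4 * Real.pi * a * t))⁻¹ * Real.exp (-x ^ 2 / (4 * a * t))

/-- The operator `w ↦ wₜ - a(x,t) wₓₓ + γ w`, applied to `w = w(x,t)`. -/
def parabolicOp (a : ℝ × ℝ → ℝ) (γ : ℝ) (w : ℝ → ℝ → ℝ) (x t : ℝ) : ℝ :=
  deriv (fun t' => w x t') t - a (x, t) * iteratedDeriv 2 (fun x' => w x' t) x + γ * w x t

/-- The parametrix `H^{ξ,τ}(x - ξ, t - τ)`: the heat kernel with the diffusion coefficient frozen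
at the source point `(ξ, τ)`. -/
def frozenKernel (a : ℝ × ℝ → ℝ) (x t ξ τ : ℝ) : ℝ :=
  heatKernel (a (ξ, τ)) (x - ξ) (t - τ)

/-- The error of the parametrix: minus the operator, in the variables `(x, t)`, applied to it. -/
def parametrixError (a : ℝ × ℝ → ℝ) (γ x t ξ τ : ℝ) : ℝ :=
  -parabolicOp a γ (fun x' t' => frozenKernel a x' t' ξ τ) x t

/-- The iterated kernels of the parametrix error under space-time convolution. -/
def iteratedError (a : ℝ × ℝ → ℝ) (γ : ℝ) : ℕ → ℝ → ℝ → ℝ → ℝ → ℝ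
  | 0, x, t, ξ, τ => parametrixError a γ x t ξ τ
  | n + 1, x, t, ξ, τ =>
      ∫ s in τ..t, ∫ y : ℝ, parametrixError a γ x t y s * iteratedError a γ n y s ξ τ

/-- The density `Φ` of the correction term, the solution
of `Φ = K + ∫∫ K Φ` (`K` the parametrix error) given by its Neumann series. -/
def density (a : ℝ × ℝ → ℝ) (γ x t ξ τ : ℝ) : ℝ :=
  ∑' n : ℕ, iteratedError a γ n x t ξ τ

/-- The kernel `Γ(x,t;ξ,τ)` (`t > τ`) of `∂ₜ - a ∂ₓₓ + γ` built by the parametrix method. -/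
def Gam (a : ℝ × ℝ → ℝ) (γ x t ξ τ : ℝ) : ℝ :=
  frozenKernel a x t ξ τ +
    ∫ s in τ..t, ∫ y : ℝ, frozenKernel a x t y s * density a γ y s ξ τ

/-- The derivative `Γₓ(x,t;ξ,τ)`. -/
def GamX (a : ℝ × ℝ → ℝ) (γ x t ξ τ : ℝ) : ℝ :=
  deriv (fun x' => Gam a γ x' t ξ τ) x

/-- On `ℝ × [0,T]` every series and integral in the construction of `Γ` converges absolutely,
and `Γ` is differentiable in `x`. -/
structure WellDefined (a : ℝ × ℝ → ℝ) (γ T : ℝ) : Prop where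
  iterated : ∀ x t ξ τ : ℝ, 0 ≤ τ → τ < t → t ≤ T → ∀ n : ℕ,
    IntegrableOn (fun q : ℝ × ℝ =>
      parametrixError a γ x t q.1 q.2 * iteratedError a γ n q.1 q.2 ξ τ) (univ ×ˢ Ioo τ t)
  series : ∀ x t ξ τ : ℝ, 0 ≤ τ → τ < t → t ≤ T →
    Summable (fun n : ℕ => |iteratedError a γ n x t ξ τ|)
  correction : ∀ x t ξ τ : ℝ, 0 ≤ τ → τ < t → t ≤ T →
    IntegrableOn (fun q : ℝ × ℝ =>
      frozenKernel a x t q.1 q.2 * density a γ q.1 q.2 ξ τ) (univ ×ˢ Ioo τ t)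
  differentiable : ∀ x t ξ τ : ℝ, 0 ≤ τ → τ < t → t ≤ T →
    DifferentiableAt ℝ (fun x' => Gam a γ x' t ξ τ) x

/-- The Duhamel integral `M_f`. -/
def duhamel (a : ℝ × ℝ → ℝ) (γ : ℝ) (f : ℝ × ℝ → ℝ) (p : ℝ × ℝ) : ℝ :=
  ∫ τ in (0 : ℝ)..p.2, ∫ ξ : ℝ, Gam a γ p.1 p.2 ξ τ * f (ξ, τ)

/-- The Duhamel integral `M_{f,x}` with kernel `Γₓ`. -/
def duhamelX (a : ℝ × ℝ → ℝ) (γ : ℝ) (f : ℝ × ℝ → ℝ) (p : ℝ × ℝ) : ℝ :=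
  ∫ τ in (0 : ℝ)..p.2, ∫ ξ : ℝ, GamX a γ p.1 p.2 ξ τ * f (ξ, τ)

/-- Lebesgue measure on `Ω_T = ℝ × (0,T]`. -/
def stripMeasure (T : ℝ) : Measure (ℝ × ℝ) :=
  (volume : Measure (ℝ × ℝ)).restrict (univ ×ˢ Ioc 0 T)

/-- The norm of `L^∞((0,T), L²(ℝ))`. -/
def normLinfL2 (T : ℝ) (f : ℝ × ℝ → ℝ) : ℝ≥0∞ :=
  essSup (fun t : ℝ => eLpNorm (fun x : ℝ => f (x, t)) 2 volume)
    ((volume : Measure ℝ).restrict (Ioo 0 T))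

end ParabolicKernel

end

/-!
All kernels are compared with `u(t - τ) H(x - ξ, t - τ)`, where `H` is the heat kernel of the single
operator `∂ₜ - 2M ∂ₓₓ` and `u` is a profile in time. By the semigroup property of `H`, the Volterra
composition of two kernels is again bounded in this way, by the convolution of the two profiles, so
that the parametrix series is governed by an estimate in one variable. The parametrix has profile
`k`, its `x`-derivative `k t^(-1/2)`, and its error `k t^(-1 + α/2)` when the coefficient is
`α`-Hölder; with the weight `e^(l t)` and `l` large, convolution with the last profile halves the
next term of the Neumann series. Hence `Φ` has profile `k t^(-1 + α/2)`, `Γ` has profile `k` and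
`Γₓ` has profile `k t^(-1/2)`.

The bounds in `L²` are Schur's test, since `u(t - τ) H(x - ξ, t - τ)` has mass `∫₀ᵀ u` in each
variable. The bounds in `L^∞` are the Cauchy–Schwarz inequality, in both variables for `Γ` and in
space only for `Γₓ`, together with `∫ H(x - ξ, t)² dξ ≤ c t^(-1/2)`.
-/

namespace ParabolicKernel

/-! ### The heat kernel and the parametrix -/

lemma heatKernel_nonneg (c x t : ℝ) : 0 ≤ heatKernel c x t := by
  unfold heatKernel; positivity

lemma heatKernel_of_nonpos {c t : ℝ} (hc : 0 ≤ c) (ht : t ≤ 0) (x : ℝ) : heatKernel c x t = 0 := by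
  have : 4 * Real.pi * c * t ≤ 0 := mul_nonpos_of_nonneg_of_nonpos (by positivity) ht
  simp [heatKernel, Real.sqrt_eq_zero_of_nonpos this]

lemma heatKernel_eq_gaussianPDFReal {c t : ℝ} (hc : 0 < c) (ht : 0 < t) (x y : ℝ) :
    heatKernel c (x - y) t = ProbabilityTheory.gaussianPDFReal y (2 * c * t).toNNReal x := by
  rw [heatKernel, ProbabilityTheory.gaussianPDFReal, Real.coe_toNNReal _ (by positivity)]
  ring_nf

lemma heatKernel_sub_comm (c x y t : ℝ) : heatKernel c (x - y) t = heatKernel c (y - x) t := by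
  rw [heatKernel, heatKernel, ← neg_sub, neg_sq]

lemma heatKernel_le {c t : ℝ} (hc : 0 < c) (ht : 0 < t) (x : ℝ) :
    heatKernel c x t ≤ heatKernel c 0 1 * t ^ (-(1 / 2) : ℝ) := by
  have hexp : Real.exp (-x ^ 2 / (4 * c * t)) ≤ 1 := by
    rw [Real.exp_le_one_iff, neg_div]
    exact neg_nonpos.2 (by positivity)
  calc heatKernel c x t ≤ (√(4 * Real.pi * c * t))⁻¹ * 1 := by unfold heatKernel; gcongr
    _ = heatKernel c 0 1 * t ^ (-(1 / 2) : ℝ) := by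
        rw [Real.sqrt_mul (by positivity), mul_inv, Real.rpow_neg ht.le, Real.sqrt_eq_rpow t]
        simp [heatKernel]

@[fun_prop]
lemma measurable_heatKernel {Ω : Type*} [MeasurableSpace Ω] {b x t : Ω → ℝ} (hb : Measurable b)
    (hx : Measurable x) (ht : Measurable t) :
    Measurable (fun z => heatKernel (b z) (x z) (t z)) := by
  unfold heatKernel; fun_prop

lemma lintegral_heatKernel_sub {c t : ℝ} (hc : 0 < c) (ht : 0 < t) (y : ℝ) :
    ∫⁻ x, ENNReal.ofReal (heatKernel c (x - y) t) = 1 := by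
  simp_rw [heatKernel_eq_gaussianPDFReal hc ht]
  exact ProbabilityTheory.lintegral_gaussianPDFReal_eq_one _
    (Real.toNNReal_pos.2 (by positivity)).ne'

/-- Completing the square in `y`. -/
lemma heatKernel_mul_heatKernel {c s t : ℝ} (hc : 0 < c) (hs : 0 < s) (ht : 0 < t) (x y z : ℝ) :
    heatKernel c (x - y) s * heatKernel c (y - z) t = heatKernel c (x - z) (s + t) *
      heatKernel c (y - (t * x + s * z) / (s + t)) (s * t / (s + t)) := by
  have : 0 < s + t := by positivity
  have hsqrt : (√(4 * Real.pi * c * s))⁻¹ * (√(4 * Real.pi * c * t))⁻¹ =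
      (√(4 * Real.pi * c * (s + t)))⁻¹ * (√(4 * Real.pi * c * (s * t / (s + t))))⁻¹ := by
    rw [← mul_inv, ← mul_inv, ← Real.sqrt_mul (by positivity), ← Real.sqrt_mul (by positivity)]
    congr 2
    field_simp
  have hexp : Real.exp (-(x - y) ^ 2 / (4 * c * s)) * Real.exp (-(y - z) ^ 2 / (4 * c * t)) =
      Real.exp (-(x - z) ^ 2 / (4 * c * (s + t))) *
        Real.exp (-(y - (t * x + s * z) / (s + t)) ^ 2 / (4 * c * (s * t / (s + t)))) := by
    rw [← Real.exp_add, ← Real.exp_add]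
    congr 1
    field_simp
    ring
  unfold heatKernel
  rw [mul_mul_mul_comm, hsqrt, hexp, mul_mul_mul_comm]

lemma lintegral_heatKernel_mul_heatKernel {c s t : ℝ} (hc : 0 < c) (hs : 0 < s) (ht : 0 < t)
    (x z : ℝ) :
    ∫⁻ y, ENNReal.ofReal (heatKernel c (x - y) s) * ENNReal.ofReal (heatKernel c (y - z) t) =
      ENNReal.ofReal (heatKernel c (x - z) (s + t)) := by
  simp_rw [← ENNReal.ofReal_mul (heatKernel_nonneg _ _ _), heatKernel_mul_heatKernel hc hs ht,
    ENNReal.ofReal_mul (heatKernel_nonneg _ _ _)]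
  rw [lintegral_const_mul _ (by fun_prop), lintegral_heatKernel_sub hc (by positivity), mul_one]

/-- The space derivative of the heat kernel. -/
noncomputable def heatKernelX (b x t : ℝ) : ℝ :=
  -(x / (2 * b * t)) * heatKernel b x t

/-- The second space derivative of the heat kernel. -/
noncomputable def heatKernelXX (b x t : ℝ) : ℝ :=
  (x ^ 2 / (2 * b * t) ^ 2 - 1 / (2 * b * t)) * heatKernel b x t

@[fun_prop]
lemma measurable_heatKernelX {Ω : Type*} [MeasurableSpace Ω] {b x t : Ω → ℝ} (hb : Measurable b)
    (hx : Measurable x) (ht : Measurable t) :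
    Measurable (fun z => heatKernelX (b z) (x z) (t z)) := by
  unfold heatKernelX; fun_prop

@[fun_prop]
lemma measurable_heatKernelXX {Ω : Type*} [MeasurableSpace Ω] {b x t : Ω → ℝ} (hb : Measurable b)
    (hx : Measurable x) (ht : Measurable t) :
    Measurable (fun z => heatKernelXX (b z) (x z) (t z)) := by
  unfold heatKernelXX; fun_prop

lemma hasDerivAt_heatKernel (b x t : ℝ) :
    HasDerivAt (fun x => heatKernel b x t) (heatKernelX b x t) x := by
  have hexponent : HasDerivAt (fun x : ℝ => -x ^ 2 / (4 * b * t)) (-(x / (2 * b * t))) x := by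
    refine ((hasDerivAt_pow 2 x).fun_neg.div_const (4 * b * t)).congr_deriv ?_
    rw [← mul_div_mul_left x (2 * b * t) two_ne_zero]
    push_cast
    ring
  unfold heatKernelX heatKernel
  exact (hexponent.exp.const_mul _).congr_deriv (by ring)

lemma hasDerivAt_heatKernelX (b x t : ℝ) :
    HasDerivAt (fun x => heatKernelX b x t) (heatKernelXX b x t) x := by
  refine (((hasDerivAt_id x).div_const (2 * b * t)).fun_neg.fun_mul
    (hasDerivAt_heatKernel b x t)).congr_deriv ?_
  simp only [heatKernelX, heatKernelXX, id]
  ring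

lemma hasDerivAt_heatKernel_time {b t : ℝ} (hb : 0 < b) (ht : 0 < t) (x : ℝ) :
    HasDerivAt (fun t => heatKernel b x t) (b * heatKernelXX b x t) t := by
  have hpos : 0 < 4 * Real.pi * b * t := by positivity
  have hsqrt := (((hasDerivAt_id t).const_mul (4 * Real.pi * b)).sqrt hpos.ne').fun_inv
    (Real.sqrt_pos.2 hpos).ne'
  have hexponent : HasDerivAt (fun t : ℝ => -x ^ 2 / (4 * b * t)) (x ^ 2 / (4 * b * t ^ 2)) t := by
    refine ((hasDerivAt_const t (-x ^ 2)).fun_div ((hasDerivAt_id t).const_mul (4 * b))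
      (by simp only [id]; positivity)).congr_deriv ?_
    simp only [id]
    field_simp
    ring
  unfold heatKernelXX heatKernel
  refine (hsqrt.fun_mul hexponent.exp).congr_deriv ?_
  have hsq : √(4 * Real.pi * b * t) ^ 2 = 4 * Real.pi * b * t := Real.sq_sqrt hpos.le
  have hne := (Real.sqrt_pos.2 hpos).ne'
  simp only [id, hsq]
  field_simp
  ring

lemma one_add_sq_le_mul_exp {M r : ℝ} (hM : 0 < M) (hr : 0 ≤ r) :
    (1 + r) ^ 2 ≤ (2 + 256 * M ^ 2) * Real.exp (r / (8 * M)) := by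
  have hquad := Real.quadratic_le_exp_of_nonneg (x := r / (8 * M)) (by positivity)
  have hpos : 0 ≤ r / (8 * M) := by positivity
  have hsq : r ^ 2 = 128 * M ^ 2 * ((r / (8 * M)) ^ 2 / 2) := by field_simp; ring
  calc (1 + r) ^ 2 ≤ 2 * 1 + 2 * r ^ 2 := by nlinarith [sq_nonneg (1 - r)]
    _ ≤ 2 * Real.exp (r / (8 * M)) + 2 * (128 * M ^ 2 * Real.exp (r / (8 * M))) := by
        rw [hsq]; gcongr <;> linarith [sq_nonneg (r / (8 * M))]
    _ = (2 + 256 * M ^ 2) * Real.exp (r / (8 * M)) := by ring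

/-- Polynomial factors are absorbed by enlarging the diffusion coefficient. -/
lemma exists_mul_heatKernel_le {m M : ℝ} (hm : 0 < m) (hmM : m ≤ M) :
    ∃ C : ℝ, 0 < C ∧ ∀ b ∈ Icc m M, ∀ x t : ℝ, 0 < t →
      (1 + x ^ 2 / t) ^ 2 * heatKernel b x t ≤ C * heatKernel (2 * M) x t := by
  have hM : 0 < M := hm.trans_le hmM
  refine ⟨(2 + 256 * M ^ 2) * √(2 * M / m), by positivity, fun b ⟨hb, hbM⟩ x t ht => ?_⟩
  have hb0 : 0 < b := hm.trans_le hb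
  have hexp : Real.exp (-x ^ 2 / (4 * b * t)) ≤ Real.exp (-(x ^ 2 / t / (4 * M))) := by
    rw [show -x ^ 2 / (4 * b * t) = -(x ^ 2 / t / (4 * b)) by field_simp]
    gcongr
  have hsqrt : (√(4 * Real.pi * b * t))⁻¹ ≤
      √(2 * M / m) * (√(4 * Real.pi * (2 * M) * t))⁻¹ := by
    have : √(2 * M / m) * (√(4 * Real.pi * (2 * M) * t))⁻¹ = (√(4 * Real.pi * m * t))⁻¹ := by
      rw [← Real.sqrt_inv, ← Real.sqrt_inv, ← Real.sqrt_mul (by positivity)]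
      congr 1
      field_simp
    rw [this]
    gcongr
  calc (1 + x ^ 2 / t) ^ 2 * heatKernel b x t
      ≤ ((2 + 256 * M ^ 2) * Real.exp (x ^ 2 / t / (8 * M))) *
        ((√(2 * M / m) * (√(4 * Real.pi * (2 * M) * t))⁻¹) *
          Real.exp (-(x ^ 2 / t / (4 * M)))) := by
        unfold heatKernel
        gcongr
        exact one_add_sq_le_mul_exp hM (by positivity)
    _ = (2 + 256 * M ^ 2) * √(2 * M / m) * ((√(4 * Real.pi * (2 * M) * t))⁻¹ *
          Real.exp (x ^ 2 / t / (8 * M) + -(x ^ 2 / t / (4 * M)))) := by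
        rw [Real.exp_add]; ring
    _ = (2 + 256 * M ^ 2) * √(2 * M / m) * heatKernel (2 * M) x t := by
        rw [heatKernel]
        congr 3
        field_simp
        ring

lemma exists_heatKernel_le {m M : ℝ} (hm : 0 < m) (hmM : m ≤ M) :
    ∃ C : ℝ, 0 < C ∧ ∀ b ∈ Icc m M, ∀ x t : ℝ, 0 < t →
      heatKernel b x t ≤ C * heatKernel (2 * M) x t := by
  obtain ⟨C, hC, hle⟩ := exists_mul_heatKernel_le hm hmM
  refine ⟨C, hC, fun b hb x t ht => le_trans ?_ (hle b hb x t ht)⟩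
  have : 0 ≤ x ^ 2 / t := by positivity
  exact le_mul_of_one_le_left (heatKernel_nonneg _ _ _) (one_le_pow₀ (by linarith))

lemma exists_abs_heatKernelX_le {m M : ℝ} (hm : 0 < m) (hmM : m ≤ M) :
    ∃ C : ℝ, 0 < C ∧ ∀ b ∈ Icc m M, ∀ x t : ℝ, 0 < t →
      |heatKernelX b x t| ≤ C * t ^ (-(1 / 2) : ℝ) * heatKernel (2 * M) x t := by
  obtain ⟨C, hC, hle⟩ := exists_mul_heatKernel_le hm hmM
  refine ⟨C / (2 * m), by positivity, fun b hb x t ht => ?_⟩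
  have hb0 : 0 < b := hm.trans_le hb.1
  have hfactor : |x| / t ≤ t ^ (-(1 / 2) : ℝ) * (1 + x ^ 2 / t) ^ 2 := by
    have hsqrt : t ^ (-(1 / 2) : ℝ) = (√t)⁻¹ := by rw [Real.rpow_neg ht.le, Real.sqrt_eq_rpow]
    have hx : |x| / √t ≤ (1 + (|x| / √t) ^ 2) ^ 2 := by
      nlinarith [sq_nonneg (|x| / √t - 1), sq_nonneg (|x| / √t), sq_nonneg ((|x| / √t) ^ 2)]
    rw [div_pow, sq_abs, Real.sq_sqrt ht.le] at hx
    calc |x| / t = (√t)⁻¹ * (|x| / √t) := by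
          rw [inv_mul_eq_div, div_div, Real.mul_self_sqrt ht.le]
      _ ≤ t ^ (-(1 / 2) : ℝ) * (1 + x ^ 2 / t) ^ 2 := by rw [hsqrt]; gcongr
  calc |heatKernelX b x t| = |x| / t / (2 * b) * heatKernel b x t := by
        rw [heatKernelX, abs_mul, abs_neg, abs_div, abs_of_nonneg (heatKernel_nonneg _ _ _),
          abs_of_pos (by positivity : 0 < 2 * b * t), div_div, mul_comm t]
    _ ≤ t ^ (-(1 / 2) : ℝ) * (1 + x ^ 2 / t) ^ 2 / (2 * m) * heatKernel b x t := by
        have := heatKernel_nonneg b x t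
        gcongr
        exact hb.1
    _ = t ^ (-(1 / 2) : ℝ) / (2 * m) * ((1 + x ^ 2 / t) ^ 2 * heatKernel b x t) := by ring
    _ ≤ t ^ (-(1 / 2) : ℝ) / (2 * m) * (C * heatKernel (2 * M) x t) := by
        exact mul_le_mul_of_nonneg_left (hle b hb x t ht) (by positivity)
    _ = C / (2 * m) * t ^ (-(1 / 2) : ℝ) * heatKernel (2 * M) x t := by ring

lemma exists_mul_abs_heatKernelXX_le {m M : ℝ} (hm : 0 < m) (hmM : m ≤ M) :
    ∃ C : ℝ, 0 < C ∧ ∀ b ∈ Icc m M, ∀ x t : ℝ, 0 < t →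
      (1 + x ^ 2 / t) * |heatKernelXX b x t| ≤ C * t⁻¹ * heatKernel (2 * M) x t := by
  obtain ⟨C, hC, hle⟩ := exists_mul_heatKernel_le hm hmM
  refine ⟨C * (1 / (4 * m ^ 2) + 1 / (2 * m)), by positivity, fun b hb x t ht => ?_⟩
  have hb0 : 0 < b := hm.trans_le hb.1
  have hfactor : |x ^ 2 / (2 * b * t) ^ 2 - 1 / (2 * b * t)| ≤
      t⁻¹ * ((1 / (4 * m ^ 2) + 1 / (2 * m)) * (1 + x ^ 2 / t)) := by
    calc |x ^ 2 / (2 * b * t) ^ 2 - 1 / (2 * b * t)|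
        ≤ x ^ 2 / (2 * b * t) ^ 2 + 1 / (2 * b * t) := by
          refine (abs_sub _ _).trans_eq ?_
          rw [abs_of_nonneg (by positivity), abs_of_nonneg (by positivity)]
      _ = t⁻¹ * (1 / (4 * b ^ 2) * (x ^ 2 / t) + 1 / (2 * b) * 1) := by field_simp; ring
      _ ≤ t⁻¹ * (1 / (4 * m ^ 2) * (1 + x ^ 2 / t) + 1 / (2 * m) * (1 + x ^ 2 / t)) := by
          have : 0 ≤ x ^ 2 / t := by positivity
          gcongr
          exacts [hb.1, by linarith, hb.1, by linarith]
      _ = _ := by ring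
  calc (1 + x ^ 2 / t) * |heatKernelXX b x t|
      = (1 + x ^ 2 / t) * |x ^ 2 / (2 * b * t) ^ 2 - 1 / (2 * b * t)| * heatKernel b x t := by
        rw [heatKernelXX, abs_mul, abs_of_nonneg (heatKernel_nonneg _ _ _), ← mul_assoc]
    _ ≤ (1 + x ^ 2 / t) * (t⁻¹ * ((1 / (4 * m ^ 2) + 1 / (2 * m)) * (1 + x ^ 2 / t))) *
          heatKernel b x t := by
        have := heatKernel_nonneg b x t
        gcongr
    _ = (1 / (4 * m ^ 2) + 1 / (2 * m)) * t⁻¹ * ((1 + x ^ 2 / t) ^ 2 * heatKernel b x t) := by ring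
    _ ≤ (1 / (4 * m ^ 2) + 1 / (2 * m)) * t⁻¹ * (C * heatKernel (2 * M) x t) := by
        exact mul_le_mul_of_nonneg_left (hle b hb x t ht) (by positivity)
    _ = C * (1 / (4 * m ^ 2) + 1 / (2 * m)) * t⁻¹ * heatKernel (2 * M) x t := by ring

/-- The derivative in `x` of the parametrix. -/
noncomputable def frozenKernelX (a : ℝ × ℝ → ℝ) (x t ξ τ : ℝ) : ℝ :=
  heatKernelX (a (ξ, τ)) (x - ξ) (t - τ)

lemma hasDerivAt_frozenKernel (a : ℝ × ℝ → ℝ) (x t ξ τ : ℝ) :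
    HasDerivAt (fun x' => frozenKernel a x' t ξ τ) (frozenKernelX a x t ξ τ) x :=
  (hasDerivAt_heatKernel _ (x - ξ) _).comp_sub_const x ξ

lemma parametrixError_eq {a : ℝ × ℝ → ℝ} {γ x t ξ τ : ℝ} (ha : 0 < a (ξ, τ)) (h : τ < t) :
    parametrixError a γ x t ξ τ =
      (a (x, t) - a (ξ, τ)) * heatKernelXX (a (ξ, τ)) (x - ξ) (t - τ)
        - γ * heatKernel (a (ξ, τ)) (x - ξ) (t - τ) := by
  have htime : deriv (fun t' => frozenKernel a x t' ξ τ) t = _ :=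
    ((hasDerivAt_heatKernel_time ha (sub_pos.2 h) (x - ξ)).comp_sub_const t τ).deriv
  have hspace : iteratedDeriv 2 (fun x' => frozenKernel a x' t ξ τ) x =
      heatKernelXX (a (ξ, τ)) (x - ξ) (t - τ) := by
    rw [iteratedDeriv_succ, iteratedDeriv_one,
      funext fun x' => (hasDerivAt_frozenKernel a x' t ξ τ).deriv]
    exact ((hasDerivAt_heatKernelX _ (x - ξ) _).comp_sub_const x ξ).deriv
  rw [parametrixError, parabolicOp, htime, hspace, frozenKernel]
  ring

/-! ### Profiles in time -/

/-- Convolution on `(0, t)` of profiles in time. -/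
noncomputable def timeConv (u v : ℝ → ℝ≥0∞) (t : ℝ) : ℝ≥0∞ :=
  ∫⁻ s in Ioo 0 t, u (t - s) * v s

/-- The profile `k t^(-α)`. -/
noncomputable def powerProfile (k α t : ℝ) : ℝ≥0∞ :=
  ENNReal.ofReal k * ENNReal.ofReal (t ^ (-α))

/-- The profile `k t^(-α) e^(l t)`; the weight `e^(l t)` makes convolution with a power profile
contractive for large `l`. -/
noncomputable def expProfile (k α l t : ℝ) : ℝ≥0∞ :=
  powerProfile k α t * ENNReal.ofReal (Real.exp (l * t))

@[fun_prop]
lemma measurable_powerProfile (k α : ℝ) : Measurable (powerProfile k α) := by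
  unfold powerProfile; fun_prop

@[fun_prop]
lemma measurable_expProfile (k α l : ℝ) : Measurable (expProfile k α l) := by
  unfold expProfile; fun_prop

lemma powerProfile_ne_top (k α t : ℝ) : powerProfile k α t ≠ ∞ :=
  ENNReal.mul_ne_top ENNReal.ofReal_ne_top ENNReal.ofReal_ne_top

lemma expProfile_ne_top (k α l t : ℝ) : expProfile k α l t ≠ ∞ :=
  ENNReal.mul_ne_top (powerProfile_ne_top k α t) ENNReal.ofReal_ne_top

lemma powerProfile_add {k k' : ℝ} (hk : 0 ≤ k) (hk' : 0 ≤ k') (α t : ℝ) :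
    powerProfile (k + k') α t = powerProfile k α t + powerProfile k' α t := by
  rw [powerProfile, ENNReal.ofReal_add hk hk', add_mul, powerProfile, powerProfile]

lemma lintegral_Ioo_sub_eq_timeConv (u v : ℝ → ℝ≥0∞) (τ t : ℝ) :
    ∫⁻ s in Ioo τ t, u (t - s) * v (s - τ) = timeConv u v (t - τ) := by
  have himage : (fun s => s + τ) '' Ioo 0 (t - τ) = Ioo τ t := by simp
  rw [timeConv, ← himage, lintegral_image_eq_lintegral_abs_deriv_mul measurableSet_Ioo
    (fun s _ => ((hasDerivAt_id' s).add_const τ).hasDerivWithinAt) (add_left_injective τ).injOn]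
  exact lintegral_congr fun s => by simp [sub_sub, add_comm τ]

lemma lintegral_Ioo_eq_mul_lintegral_unit {t : ℝ} (ht : 0 < t) (f : ℝ → ℝ≥0∞) :
    ∫⁻ s in Ioo 0 t, f s = ENNReal.ofReal t * ∫⁻ r in Ioo 0 1, f (t * r) := by
  have himage : (fun r => t * r) '' Ioo 0 1 = Ioo 0 t := by
    rw [image_mul_left_Ioo ht, mul_zero, mul_one]
  rw [← himage, lintegral_image_eq_lintegral_abs_deriv_mul measurableSet_Ioo
    (fun r _ => ((hasDerivAt_id' r).const_mul t).hasDerivWithinAt)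
    (mul_right_injective₀ ht.ne').injOn, ← lintegral_const_mul' _ _ ENNReal.ofReal_ne_top]
  simp [abs_of_pos ht]

lemma lintegral_rpow_mul_one_sub_rpow {α β : ℝ} (hα : 0 < α) (hβ : 0 < β) :
    ∫⁻ r in Ioo 0 1, ENNReal.ofReal (r ^ (α - 1) * (1 - r) ^ (β - 1)) =
      ENNReal.ofReal (ProbabilityTheory.beta α β) := by
  have hB := ProbabilityTheory.beta_pos hα hβ
  have hone := ProbabilityTheory.lintegral_betaPDF_eq_one hα hβ
  simp_rw [ProbabilityTheory.lintegral_betaPDF, mul_assoc,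
    ENNReal.ofReal_mul (one_div_pos.2 hB).le] at hone
  rw [lintegral_const_mul' _ _ ENNReal.ofReal_ne_top] at hone
  rw [ENNReal.eq_inv_of_mul_eq_one_left ((mul_comm _ _).trans hone),
    ← ENNReal.ofReal_inv_of_pos (one_div_pos.2 hB), one_div, inv_inv]

lemma timeConv_powerProfile {k k' α β t : ℝ} (hk : 0 ≤ k) (hk' : 0 ≤ k') (hα : α < 1)
    (hβ : β < 1) (ht : 0 < t) :
    timeConv (powerProfile k α) (powerProfile k' β) t =
      powerProfile (k * k' * ProbabilityTheory.beta (1 - β) (1 - α)) (α + β - 1) t := by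
  have hscale : ∀ r ∈ Ioo (0 : ℝ) 1, powerProfile k α (t - t * r) * powerProfile k' β (t * r) =
      ENNReal.ofReal (k * k' * t ^ (-α - β)) *
        ENNReal.ofReal (r ^ ((1 - β) - 1) * (1 - r) ^ ((1 - α) - 1)) := fun r hr => by
    have hr0 := hr.1
    have hr1 : 0 < 1 - r := sub_pos.2 hr.2
    rw [powerProfile, powerProfile, ← mul_one_sub, Real.mul_rpow ht.le hr1.le,
      Real.mul_rpow ht.le hr0.le, sub_eq_add_neg (-α), Real.rpow_add ht,
      ← ENNReal.ofReal_mul hk, ← ENNReal.ofReal_mul hk', ← ENNReal.ofReal_mul (by positivity),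
      ← ENNReal.ofReal_mul (by positivity)]
    ring_nf
  have hexp : t * t ^ (-α - β) = t ^ (-(α + β - 1)) := by
    rw [show -(α + β - 1) = 1 + (-α - β) by ring, Real.rpow_add ht, Real.rpow_one]
  have hB := ProbabilityTheory.beta_pos (sub_pos.2 hβ) (sub_pos.2 hα)
  rw [timeConv, lintegral_Ioo_eq_mul_lintegral_unit ht,
    setLIntegral_congr_fun measurableSet_Ioo hscale,
    lintegral_const_mul' _ _ ENNReal.ofReal_ne_top,
    lintegral_rpow_mul_one_sub_rpow (sub_pos.2 hβ) (sub_pos.2 hα), powerProfile, ← hexp,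
    ← ENNReal.ofReal_mul (by positivity), ← ENNReal.ofReal_mul ht.le,
    ← ENNReal.ofReal_mul (by positivity)]
  congr 1
  ring

lemma powerProfile_le {k k' α t : ℝ} (hkk' : k ≤ k') :
    powerProfile k α t ≤ powerProfile k' α t :=
  mul_le_mul_left (ENNReal.ofReal_le_ofReal hkk') _

lemma powerProfile_le_of_exponent_le {k α β t T₀ : ℝ} (hk : 0 ≤ k) (hαβ : α ≤ β) (ht : 0 < t)
    (htT₀ : t ≤ T₀) : powerProfile k α t ≤ powerProfile (k * T₀ ^ (β - α)) β t := by
  have hpow : t ^ (-α) ≤ T₀ ^ (β - α) * t ^ (-β) := by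
    rw [show -α = (β - α) + -β by ring, Real.rpow_add ht]
    gcongr
  rw [powerProfile, powerProfile, ENNReal.ofReal_mul hk, mul_assoc,
    ← ENNReal.ofReal_mul (Real.rpow_nonneg (ht.le.trans htT₀) _)]
  gcongr

lemma rpow_le_exp {x η : ℝ} (hx : 0 ≤ x) (hη : 0 ≤ η) (hη1 : η ≤ 1) : x ^ η ≤ Real.exp x :=
  calc x ^ η ≤ (x + 1) ^ η := by gcongr; linarith
    _ ≤ (x + 1) ^ (1 : ℝ) := Real.rpow_le_rpow_of_exponent_le (by linarith) hη1
    _ ≤ Real.exp x := by rw [Real.rpow_one]; exact Real.add_one_le_exp x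

lemma powerProfile_mul_exp_neg_le {k α l η s : ℝ} (hk : 0 ≤ k) (hl : 0 < l) (hη : 0 ≤ η)
    (hη1 : η ≤ 1) (hs : 0 < s) :
    powerProfile k α s * ENNReal.ofReal (Real.exp (-(l * s))) ≤
      powerProfile (k * l ^ (-η)) (α + η) s := by
  have hexp : Real.exp (-(l * s)) ≤ l ^ (-η) * s ^ (-η) := by
    rw [← Real.mul_rpow hl.le hs.le, Real.rpow_neg (by positivity), Real.exp_neg]
    gcongr
    exact rpow_le_exp (by positivity) hη hη1
  rw [powerProfile, powerProfile, mul_assoc, ← ENNReal.ofReal_mul (by positivity),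
    ← ENNReal.ofReal_mul hk, ← ENNReal.ofReal_mul (by positivity), neg_add, Real.rpow_add hs]
  refine ENNReal.ofReal_le_ofReal ?_
  calc k * (s ^ (-α) * Real.exp (-(l * s))) ≤ k * (s ^ (-α) * (l ^ (-η) * s ^ (-η))) := by gcongr
    _ = k * l ^ (-η) * (s ^ (-α) * s ^ (-η)) := by ring

lemma timeConv_expProfile_le {k k' α β l η : ℝ} (hk : 0 ≤ k) (hl : 0 < l) (hη : 0 ≤ η)
    (hη1 : η ≤ 1) (t : ℝ) :
    timeConv (powerProfile k α) (expProfile k' β l) t ≤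
      timeConv (powerProfile (k * l ^ (-η)) (α + η)) (powerProfile k' β) t *
        ENNReal.ofReal (Real.exp (l * t)) := by
  rw [timeConv, timeConv, ← lintegral_mul_const' _ _ ENNReal.ofReal_ne_top]
  refine setLIntegral_mono' measurableSet_Ioo fun s hs => ?_
  have hexp : ENNReal.ofReal (Real.exp (l * s)) =
      ENNReal.ofReal (Real.exp (-(l * (t - s)))) * ENNReal.ofReal (Real.exp (l * t)) := by
    rw [← ENNReal.ofReal_mul (Real.exp_nonneg _), ← Real.exp_add]
    ring_nf
  calc powerProfile k α (t - s) * expProfile k' β l s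
      = powerProfile k α (t - s) * ENNReal.ofReal (Real.exp (-(l * (t - s)))) *
          powerProfile k' β s * ENNReal.ofReal (Real.exp (l * t)) := by
        rw [expProfile, hexp]; ring
    _ ≤ powerProfile (k * l ^ (-η)) (α + η) (t - s) * powerProfile k' β s *
          ENNReal.ofReal (Real.exp (l * t)) := by
        gcongr
        exact powerProfile_mul_exp_neg_le hk hl hη hη1 (sub_pos.2 hs.2)

lemma exists_timeConv_expProfile_le {k β T₀ : ℝ} (hk : 0 < k) (hβ0 : 0 ≤ β) (hβ : β < 1)
    (hT₀ : 0 < T₀) :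
    ∃ l : ℝ, 0 < l ∧ ∀ k' t : ℝ, 0 ≤ k' → 0 < t → t ≤ T₀ →
      timeConv (powerProfile k β) (expProfile k' β l) t ≤ expProfile (k' / 2) β l t := by
  set η := (1 - β) / 2 with hη
  have hη0 : 0 < η := by rw [hη]; linarith
  set B := ProbabilityTheory.beta (1 - β) (1 - (β + η))
  have hB : 0 < B := ProbabilityTheory.beta_pos (by linarith) (by rw [hη]; linarith)
  set l := T₀ * (2 * k * B) ^ η⁻¹ with hl
  have hl0 : 0 < l := by positivity
  have hl_spec : l ^ (-η) * T₀ ^ η * (2 * k * B) = 1 := by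
    rw [hl, Real.mul_rpow hT₀.le (by positivity), ← Real.rpow_mul (by positivity),
      inv_mul_eq_div, neg_div, div_self hη0.ne', Real.rpow_neg_one, Real.rpow_neg hT₀.le]
    field_simp
  refine ⟨l, hl0, fun k' t hk' ht htT₀ => ?_⟩
  calc timeConv (powerProfile k β) (expProfile k' β l) t
      ≤ timeConv (powerProfile (k * l ^ (-η)) (β + η)) (powerProfile k' β) t *
          ENNReal.ofReal (Real.exp (l * t)) :=
        timeConv_expProfile_le hk.le hl0 hη0.le (by rw [hη]; linarith) t
    _ = powerProfile (k * l ^ (-η) * k' * B) (β - η) t * ENNReal.ofReal (Real.exp (l * t)) := by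
        rw [timeConv_powerProfile (by positivity) hk' (by rw [hη]; linarith) hβ ht]
        congr 2
        rw [hη]; ring
    _ ≤ powerProfile (k * l ^ (-η) * k' * B * T₀ ^ (β - (β - η))) β t *
          ENNReal.ofReal (Real.exp (l * t)) := by
        gcongr
        exact powerProfile_le_of_exponent_le (by positivity) (by linarith) ht htT₀
    _ = expProfile (k' / 2) β l t := by
        rw [expProfile, sub_sub_cancel]
        congr 2
        linear_combination k' / 2 * hl_spec

/-! ### Kernels with a heat-kernel bound -/

/-- The space-time kernel `u(t - τ) H(x - ξ, t - τ)`, with `H` the heat kernel of `∂ₜ - c ∂ₓₓ`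
and `u` a profile in time. -/
noncomputable def profileKernel (c : ℝ) (u : ℝ → ℝ≥0∞) (p q : ℝ × ℝ) : ℝ≥0∞ :=
  u (p.2 - q.2) * ENNReal.ofReal (heatKernel c (p.1 - q.1) (p.2 - q.2))

lemma profileKernel_of_le {c : ℝ} (hc : 0 ≤ c) (u : ℝ → ℝ≥0∞) {p q : ℝ × ℝ} (h : p.2 ≤ q.2) :
    profileKernel c u p q = 0 := by
  simp [profileKernel, heatKernel_of_nonpos hc (sub_nonpos.2 h)]

lemma profileKernel_eq_sub_zero (c : ℝ) (u : ℝ → ℝ≥0∞) (p q : ℝ × ℝ) :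
    profileKernel c u p q = profileKernel c u (p - q) 0 := by
  simp [profileKernel]

lemma profileKernel_mono {c : ℝ} {u v : ℝ → ℝ≥0∞} {p q : ℝ × ℝ}
    (h : u (p.2 - q.2) ≤ v (p.2 - q.2)) : profileKernel c u p q ≤ profileKernel c v p q :=
  mul_le_mul_left h _

lemma profileKernel_ne_top {c : ℝ} {u : ℝ → ℝ≥0∞} {p q : ℝ × ℝ} (h : u (p.2 - q.2) ≠ ∞) :
    profileKernel c u p q ≠ ∞ :=
  ENNReal.mul_ne_top h ENNReal.ofReal_ne_top

@[fun_prop]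
lemma measurable_profileKernel {Ω : Type*} [MeasurableSpace Ω] (c : ℝ) {u : ℝ → ℝ≥0∞}
    (hu : Measurable u) {p q : Ω → ℝ × ℝ} (hp : Measurable p) (hq : Measurable q) :
    Measurable (fun z => profileKernel c u (p z) (q z)) := by
  unfold profileKernel; fun_prop

lemma lintegral_slice_profileKernel_mul {c : ℝ} (hc : 0 < c) (u v : ℝ → ℝ≥0∞) (p q : ℝ × ℝ)
    (s : ℝ) :
    ∫⁻ y, profileKernel c u p (y, s) * profileKernel c v (y, s) q =
      (Ioo q.2 p.2).indicator (fun s => u (p.2 - s) * v (s - q.2)) s *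
        ENNReal.ofReal (heatKernel c (p.1 - q.1) (p.2 - q.2)) := by
  by_cases hs : s ∈ Ioo q.2 p.2
  · simp only [profileKernel, mul_mul_mul_comm (u _)]
    rw [lintegral_const_mul _ (by fun_prop), lintegral_heatKernel_mul_heatKernel hc
      (sub_pos.2 hs.2) (sub_pos.2 hs.1), indicator_of_mem hs, sub_add_sub_cancel]
  · rw [indicator_of_notMem hs, zero_mul]
    refine (lintegral_congr fun y => ?_).trans lintegral_zero
    rcases le_or_gt s q.2 with hsq | hsq
    · rw [profileKernel_of_le hc.le v hsq, mul_zero]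
    · rw [profileKernel_of_le hc.le u (not_lt.1 fun hsp => hs ⟨hsq, hsp⟩), zero_mul]

lemma lintegral_profileKernel_mul {c : ℝ} (hc : 0 < c) {u v : ℝ → ℝ≥0∞} (hu : Measurable u)
    (hv : Measurable v) (p q : ℝ × ℝ) :
    ∫⁻ r, profileKernel c u p r * profileKernel c v r q =
      profileKernel c (timeConv u v) p q := by
  rw [Measure.volume_eq_prod, lintegral_prod_symm _ (by fun_prop)]
  simp_rw [lintegral_slice_profileKernel_mul hc]
  rw [lintegral_mul_const _ (Measurable.indicator (by fun_prop) measurableSet_Ioo),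
    lintegral_indicator measurableSet_Ioo, lintegral_Ioo_sub_eq_timeConv, profileKernel]

lemma lintegral_profileKernel_zero {c : ℝ} (hc : 0 < c) {u : ℝ → ℝ≥0∞} (hu : Measurable u) :
    ∫⁻ p, profileKernel c u p 0 = ∫⁻ s in Ioi 0, u s := by
  rw [Measure.volume_eq_prod, lintegral_prod_symm _ (by fun_prop),
    ← lintegral_indicator measurableSet_Ioi]
  refine lintegral_congr fun s => ?_
  by_cases hs : s ∈ Ioi 0
  · simp only [profileKernel, Prod.fst_zero, Prod.snd_zero]
    rw [lintegral_const_mul _ (by fun_prop), indicator_of_mem hs, sub_zero s,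
      lintegral_heatKernel_sub hc hs, mul_one]
  · rw [indicator_of_notMem hs]
    exact (lintegral_congr fun y => profileKernel_of_le (p := (y, s)) (q := 0) hc.le u
      (not_lt.1 hs)).trans lintegral_zero

lemma lintegral_profileKernel_left {c : ℝ} (hc : 0 < c) {u : ℝ → ℝ≥0∞} (hu : Measurable u)
    (q : ℝ × ℝ) : ∫⁻ p, profileKernel c u p q = ∫⁻ s in Ioi 0, u s := by
  rw [← lintegral_profileKernel_zero hc hu,
    ← lintegral_sub_right_eq_self (fun p => profileKernel c u p 0) q]
  exact lintegral_congr fun p => profileKernel_eq_sub_zero c u p q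

lemma lintegral_profileKernel_right {c : ℝ} (hc : 0 < c) {u : ℝ → ℝ≥0∞} (hu : Measurable u)
    (p : ℝ × ℝ) : ∫⁻ q, profileKernel c u p q = ∫⁻ s in Ioi 0, u s := by
  rw [← lintegral_profileKernel_zero hc hu,
    ← lintegral_sub_left_eq_self (fun q => profileKernel c u q 0) p]
  exact lintegral_congr fun q => profileKernel_eq_sub_zero c u p q

lemma sq_lintegral_mul_le {α : Type*} [MeasurableSpace α] {μ : Measure α} {f g : α → ℝ≥0∞}
    (hf : AEMeasurable f μ) (hg : AEMeasurable g μ) :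
    (∫⁻ a, f a * g a ∂μ) ^ 2 ≤ (∫⁻ a, f a ^ 2 ∂μ) * ∫⁻ a, g a ^ 2 ∂μ := by
  have hholder := ENNReal.lintegral_mul_le_Lp_mul_Lq μ Real.HolderConjugate.two_two hf hg
  simp only [Pi.mul_apply, ENNReal.rpow_ofNat] at hholder
  refine (pow_le_pow_left' hholder 2).trans (le_of_eq ?_)
  rw [mul_pow, ← ENNReal.rpow_natCast, ← ENNReal.rpow_natCast, ← ENNReal.rpow_mul,
    ← ENNReal.rpow_mul]
  norm_num

/-- Cauchy–Schwarz for the measure `k μ`. -/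
lemma sq_lintegral_mul_le_mul_lintegral_mul_sq {α : Type*} [MeasurableSpace α] {μ : Measure α}
    {k f : α → ℝ≥0∞} (hk : AEMeasurable k μ) (hf : AEMeasurable f μ) :
    (∫⁻ a, k a * f a ∂μ) ^ 2 ≤ (∫⁻ a, k a ∂μ) * ∫⁻ a, k a * f a ^ 2 ∂μ := by
  have hcs := sq_lintegral_mul_le (μ := μ.withDensity k) (f := fun _ => 1) aemeasurable_const
    (hf.mono_ac (withDensity_absolutelyContinuous μ k))
  rw [lintegral_withDensity_eq_lintegral_mul₀ hk (by fun_prop),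
    lintegral_withDensity_eq_lintegral_mul₀ hk (by fun_prop),
    lintegral_withDensity_eq_lintegral_mul₀ hk (by fun_prop)] at hcs
  simpa only [Pi.mul_apply, one_mul, one_pow, mul_one] using hcs

lemma lintegral_sq_le_of_schur_test {α β : Type*} [MeasurableSpace α] [MeasurableSpace β]
    {μ : Measure α} {ν : Measure β} [SFinite μ] [SFinite ν] {k : α → β → ℝ≥0∞} {f : β → ℝ≥0∞}
    (hk : Measurable (Function.uncurry k)) (hf : AEMeasurable f ν) {A B : ℝ≥0∞}
    (hright : ∀ p, ∫⁻ q, k p q ∂ν ≤ A) (hleft : ∀ q, ∫⁻ p, k p q ∂μ ≤ B) :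
    ∫⁻ p, (∫⁻ q, k p q * f q ∂ν) ^ 2 ∂μ ≤ A * B * ∫⁻ q, f q ^ 2 ∂ν := by
  have hkp (p : α) : Measurable (k p) := hk.comp measurable_prodMk_left
  have hkq (q : β) : Measurable fun p => k p q := hk.comp measurable_prodMk_right
  have hmeas : AEMeasurable (Function.uncurry fun p q => k p q * f q ^ 2) (μ.prod ν) :=
    hk.aemeasurable.mul (hf.comp_snd.pow_const 2)
  calc ∫⁻ p, (∫⁻ q, k p q * f q ∂ν) ^ 2 ∂μ ≤ ∫⁻ p, A * ∫⁻ q, k p q * f q ^ 2 ∂ν ∂μ :=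
        lintegral_mono fun p => (sq_lintegral_mul_le_mul_lintegral_mul_sq
          (hkp p).aemeasurable hf).trans (mul_le_mul_left (hright p) _)
    _ = A * ∫⁻ q, ∫⁻ p, k p q * f q ^ 2 ∂μ ∂ν := by
        rw [lintegral_const_mul'' _ hmeas.lintegral_prod_right, lintegral_lintegral_swap hmeas]
    _ ≤ A * ∫⁻ q, B * f q ^ 2 ∂ν := by
        gcongr with q
        rw [lintegral_mul_const _ (hkq q)]
        exact mul_le_mul_left (hleft q) _
    _ = A * B * ∫⁻ q, f q ^ 2 ∂ν := by
        rw [lintegral_const_mul'' _ (hf.pow_const 2), mul_assoc]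

lemma powerProfile_mul {k k' t : ℝ} (hk : 0 ≤ k) (α β : ℝ) (ht : 0 < t) :
    powerProfile k α t * powerProfile k' β t = powerProfile (k * k') (α + β) t := by
  rw [powerProfile, powerProfile, powerProfile, mul_mul_mul_comm, ← ENNReal.ofReal_mul hk,
    ← ENNReal.ofReal_mul (by positivity), neg_add, Real.rpow_add ht]

lemma ofReal_heatKernel_le {c t : ℝ} (hc : 0 < c) (ht : 0 < t) (x : ℝ) :
    ENNReal.ofReal (heatKernel c x t) ≤ powerProfile (heatKernel c 0 1) (1 / 2) t := by
  rw [powerProfile, ← ENNReal.ofReal_mul (heatKernel_nonneg _ _ _)]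
  exact ENNReal.ofReal_le_ofReal (heatKernel_le hc ht x)

lemma sq_lintegral_profileKernel_mul_le {c : ℝ} (hc : 0 < c) {u : ℝ → ℝ≥0∞} (hu : Measurable u)
    {F : ℝ × ℝ → ℝ≥0∞} (hF : AEMeasurable F) (p : ℝ × ℝ) :
    (∫⁻ q, profileKernel c u p q * F q) ^ 2 ≤
      (∫⁻ s in Ioi 0, u s ^ 2 * powerProfile (heatKernel c 0 1) (1 / 2) s) * ∫⁻ q, F q ^ 2 := by
  refine (sq_lintegral_mul_le (by fun_prop) hF).trans ?_
  rw [← lintegral_profileKernel_right hc (by fun_prop) p]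
  gcongr with q
  rcases le_or_gt p.2 q.2 with h | h
  · simp [profileKernel_of_le hc.le u h]
  · rw [profileKernel, profileKernel, mul_pow, mul_assoc, sq (ENNReal.ofReal _)]
    gcongr
    exact ofReal_heatKernel_le hc (sub_pos.2 h) _

lemma lintegral_heatKernel_mul_le {c t : ℝ} (hc : 0 < c) (ht : 0 < t) (x : ℝ) {f : ℝ → ℝ≥0∞}
    (hf : AEMeasurable f) {N : ℝ≥0∞} (hN : ∫⁻ y, f y ^ 2 ≤ N ^ 2) :
    ∫⁻ y, ENNReal.ofReal (heatKernel c (x - y) t) * f y ≤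
      powerProfile (√(heatKernel c 0 1)) (1 / 4) t * N := by
  have hsq : powerProfile (√(heatKernel c 0 1)) (1 / 4) t ^ 2 =
      powerProfile (heatKernel c 0 1) (1 / 2) t := by
    rw [sq, powerProfile_mul (Real.sqrt_nonneg _) _ _ ht,
      Real.mul_self_sqrt (heatKernel_nonneg _ _ _)]
    norm_num
  refine (ENNReal.pow_le_pow_left_iff two_ne_zero).1 ?_
  calc (∫⁻ y, ENNReal.ofReal (heatKernel c (x - y) t) * f y) ^ 2
      ≤ (∫⁻ y, ENNReal.ofReal (heatKernel c (x - y) t) ^ 2) * ∫⁻ y, f y ^ 2 :=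
        sq_lintegral_mul_le (by fun_prop) hf
    _ ≤ (∫⁻ y, powerProfile (heatKernel c 0 1) (1 / 2) t *
          ENNReal.ofReal (heatKernel c (y - x) t)) * N ^ 2 := by
        gcongr with y
        rw [sq, heatKernel_sub_comm]
        gcongr
        exact ofReal_heatKernel_le hc ht _
    _ = (powerProfile (√(heatKernel c 0 1)) (1 / 4) t * N) ^ 2 := by
        rw [lintegral_const_mul _ (by fun_prop), lintegral_heatKernel_sub hc ht, mul_one, mul_pow,
          hsq]

lemma lintegral_profileKernel_mul_le_of_slice {c : ℝ} (hc : 0 < c) {u : ℝ → ℝ≥0∞}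
    (hu : Measurable u) {F : ℝ × ℝ → ℝ≥0∞} (hF : AEMeasurable F) {N : ℝ≥0∞}
    (hN : ∀ᵐ s : ℝ, ∫⁻ y, F (y, s) ^ 2 ≤ N ^ 2) (p : ℝ × ℝ) :
    ∫⁻ q, profileKernel c u p q * F q ≤
      (∫⁻ s in Ioi 0, u s * powerProfile (√(heatKernel c 0 1)) (1 / 4) s) * N := by
  have hslice : ∀ᵐ s : ℝ, AEMeasurable fun y => F (y, s) :=
    (hF.aestronglyMeasurable.prodMk_right).mono fun s hs => hs.aemeasurable
  rw [Measure.volume_eq_prod, lintegral_prod_symm _ (by fun_prop),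
    ← lintegral_mul_const _ (by fun_prop), ← lintegral_indicator measurableSet_Ioi,
    ← lintegral_sub_left_eq_self ((Ioi (0 : ℝ)).indicator _) p.2]
  refine lintegral_mono_ae ?_
  filter_upwards [hN, hslice] with s hN hFs
  rcases le_or_gt p.2 s with h | h
  · have hzero (y : ℝ) : profileKernel c u p (y, s) * F (y, s) = 0 := by
      rw [profileKernel_of_le hc.le u h, zero_mul]
    simp_rw [hzero, lintegral_zero, zero_le]
  · rw [indicator_of_mem (mem_Ioi.2 (sub_pos.2 h))]
    simp only [profileKernel, mul_assoc (u _)]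
    have hheat : Measurable fun y => ENNReal.ofReal (heatKernel c (p.1 - y) (p.2 - s)) := by
      fun_prop
    rw [lintegral_const_mul'' _ (hheat.aemeasurable.fun_mul hFs)]
    gcongr
    exact lintegral_heatKernel_mul_le hc (sub_pos.2 h) _ hFs hN

/-! ### Volterra composition -/

/-- The pairs of points of `ℝ × [0, T]`, written `((x, t), (ξ, τ))`, with `τ < t`. -/
def causal (T : ℝ) : Set ((ℝ × ℝ) × (ℝ × ℝ)) :=
  {z | 0 ≤ z.2.2 ∧ z.2.2 < z.1.2 ∧ z.1.2 ≤ T}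

/-- The kernel `G(x, t; ξ, τ)` as a function of the points `(x, t)` and `(ξ, τ)`, replaced by `0`
off `causal T`. -/
noncomputable def causalCutoff (T : ℝ) (G : ℝ → ℝ → ℝ → ℝ → ℝ) (p q : ℝ × ℝ) : ℝ :=
  (causal T).indicator (fun z => G z.1.1 z.1.2 z.2.1 z.2.2) (p, q)

/-- The Volterra composition `∫_τ^t ∫ G₁(x, t; y, s) G₂(y, s; ξ, τ) dy ds`. -/
noncomputable def kernelConv (G₁ G₂ : ℝ → ℝ → ℝ → ℝ → ℝ) (x t ξ τ : ℝ) : ℝ :=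
  ∫ s in τ..t, ∫ y, G₁ x t y s * G₂ y s ξ τ

/-- The kernel `G` is measurable on `causal T`, and there at most `u(t - τ) H(x - ξ, t - τ)`, with
`H` the heat kernel of `∂ₜ - c ∂ₓₓ`. -/
structure IsDominated (c T : ℝ) (u : ℝ → ℝ≥0∞) (G : ℝ → ℝ → ℝ → ℝ → ℝ) : Prop where
  measurable : Measurable (Function.uncurry (causalCutoff T G))
  enorm_le : ∀ p q, (p, q) ∈ causal T → ‖G p.1 p.2 q.1 q.2‖ₑ ≤ profileKernel c u p q

section Causal

variable {c T : ℝ} {u v : ℝ → ℝ≥0∞} {G G₁ G₂ G' : ℝ → ℝ → ℝ → ℝ → ℝ} {p q : ℝ × ℝ}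

lemma measurableSet_causal (T : ℝ) : MeasurableSet (causal T) := by
  unfold causal; measurability

lemma causalCutoff_of_mem (h : (p, q) ∈ causal T) :
    causalCutoff T G p q = G p.1 p.2 q.1 q.2 :=
  indicator_of_mem h _

lemma causalCutoff_of_notMem (h : (p, q) ∉ causal T) : causalCutoff T G p q = 0 :=
  indicator_of_notMem h _

lemma measurable_causalCutoff {F : (ℝ × ℝ) × (ℝ × ℝ) → ℝ} (hF : Measurable F)
    (h : ∀ p q, (p, q) ∈ causal T → G p.1 p.2 q.1 q.2 = F (p, q)) :
    Measurable (Function.uncurry (causalCutoff T G)) := by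
  convert hF.indicator (measurableSet_causal T) using 1
  ext ⟨p, q⟩
  by_cases hpq : (p, q) ∈ causal T
  · rw [Function.uncurry_apply_pair, causalCutoff_of_mem hpq, h p q hpq, indicator_of_mem hpq]
  · rw [Function.uncurry_apply_pair, causalCutoff_of_notMem hpq, indicator_of_notMem hpq]

lemma causalCutoff_mul_causalCutoff (h : (p, q) ∈ causal T) (G₁ G₂ : ℝ → ℝ → ℝ → ℝ → ℝ) :
    (fun r => causalCutoff T G₁ p r * causalCutoff T G₂ r q) =
      (univ ×ˢ Ioo q.2 p.2).indicator
        (fun r : ℝ × ℝ => G₁ p.1 p.2 r.1 r.2 * G₂ r.1 r.2 q.1 q.2) := by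
  obtain ⟨hq, -, hp⟩ := h
  ext r
  by_cases hr : r ∈ univ ×ˢ Ioo q.2 p.2
  · rw [indicator_of_mem hr]
    obtain ⟨-, hqr, hrp⟩ := hr
    rw [causalCutoff_of_mem (p := p) (q := r) ⟨hq.trans hqr.le, hrp, hp⟩,
      causalCutoff_of_mem (p := r) (q := q) ⟨hq, hqr, hrp.le.trans hp⟩]
  · rw [indicator_of_notMem hr, mul_eq_zero]
    by_contra! hne
    exact hr ⟨mem_univ _, (not_not.1 (mt causalCutoff_of_notMem hne.2)).2.1,
      (not_not.1 (mt causalCutoff_of_notMem hne.1)).2.1⟩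

lemma integrableOn_prod_Ioo_iff {a b : ℝ} {F : ℝ × ℝ → ℝ} :
    IntegrableOn F (univ ×ˢ Ioo a b) ↔
      Integrable F ((volume : Measure ℝ).prod (volume.restrict (Ioo a b))) := by
  rw [IntegrableOn, Measure.volume_eq_prod, ← Measure.prod_restrict, Measure.restrict_univ]

lemma integrableOn_integral {a b : ℝ} {F : ℝ × ℝ → ℝ} (hF : IntegrableOn F (univ ×ˢ Ioo a b)) :
    IntegrableOn (fun s => ∫ y, F (y, s)) (Ioo a b) :=
  (integrableOn_prod_Ioo_iff.1 hF).integral_prod_right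

lemma integral_integral_eq_setIntegral {a b : ℝ} (hab : a ≤ b) {F : ℝ × ℝ → ℝ}
    (hF : IntegrableOn F (univ ×ˢ Ioo a b)) :
    ∫ s in a..b, ∫ y, F (y, s) = ∫ r in univ ×ˢ Ioo a b, F r := by
  rw [intervalIntegral.integral_of_le hab, integral_Ioc_eq_integral_Ioo, Measure.volume_eq_prod,
    ← Measure.prod_restrict, Measure.restrict_univ,
    integral_prod_symm _ (integrableOn_prod_Ioo_iff.1 hF)]

namespace IsDominated

lemma mono (h : IsDominated c T u G) (huv : ∀ s ∈ Ioc 0 T, u s ≤ v s) : IsDominated c T v G where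
  measurable := h.measurable
  enorm_le p q hpq := (h.enorm_le p q hpq).trans <| profileKernel_mono <| huv _
    ⟨sub_pos.2 hpq.2.1, (sub_le_self _ hpq.1).trans hpq.2.2⟩

lemma congr (h : IsDominated c T u G)
    (hG : ∀ p q, (p, q) ∈ causal T → G' p.1 p.2 q.1 q.2 = G p.1 p.2 q.1 q.2) :
    IsDominated c T u G' where
  measurable := measurable_causalCutoff h.measurable fun p q hpq => by
    rw [hG p q hpq, Function.uncurry_apply_pair, causalCutoff_of_mem hpq]
  enorm_le p q hpq := by rw [hG p q hpq]; exact h.enorm_le p q hpq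

lemma add (h₁ : IsDominated c T u G₁) (h₂ : IsDominated c T v G₂) :
    IsDominated c T (fun t => u t + v t) (fun x t ξ τ => G₁ x t ξ τ + G₂ x t ξ τ) where
  measurable := measurable_causalCutoff (h₁.measurable.add h₂.measurable) fun p q hpq => by
    simp only [Pi.add_apply, Function.uncurry_apply_pair, causalCutoff_of_mem hpq]
  enorm_le p q hpq := by
    rw [profileKernel, add_mul]
    exact (enorm_add_le _ _).trans (add_le_add (h₁.enorm_le p q hpq) (h₂.enorm_le p q hpq))

lemma const_mul (h : IsDominated c T u G) (r : ℝ) :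
    IsDominated c T (fun t => ‖r‖ₑ * u t) (fun x t ξ τ => r * G x t ξ τ) where
  measurable := measurable_causalCutoff (h.measurable.const_mul r) fun p q hpq => by
    rw [Function.uncurry_apply_pair, causalCutoff_of_mem hpq]
  enorm_le p q hpq := by
    rw [enorm_mul, profileKernel, mul_assoc]
    exact mul_le_mul_right (h.enorm_le p q hpq) _

lemma tsum_enorm_le {U : ℕ → ℝ → ℝ≥0∞} {G : ℕ → ℝ → ℝ → ℝ → ℝ → ℝ}
    (h : ∀ n, IsDominated c T (U n) (G n)) (hpq : (p, q) ∈ causal T) :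
    ∑' n, ‖G n p.1 p.2 q.1 q.2‖ₑ ≤ profileKernel c (fun t => ∑' n, U n t) p q := by
  rw [profileKernel, ← ENNReal.tsum_mul_right]
  exact ENNReal.tsum_le_tsum fun n => (h n).enorm_le p q hpq

lemma summable_norm {U : ℕ → ℝ → ℝ≥0∞} {G : ℕ → ℝ → ℝ → ℝ → ℝ → ℝ}
    (h : ∀ n, IsDominated c T (U n) (G n)) (hU : ∀ t, ∑' n, U n t ≠ ∞)
    (hpq : (p, q) ∈ causal T) : Summable fun n => ‖G n p.1 p.2 q.1 q.2‖ :=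
  tsum_enorm_ne_top_iff_summable_norm.1 <|
    ne_top_of_le_ne_top (profileKernel_ne_top (hU _)) (tsum_enorm_le h hpq)

protected lemma tsum {U : ℕ → ℝ → ℝ≥0∞} {G : ℕ → ℝ → ℝ → ℝ → ℝ → ℝ}
    (h : ∀ n, IsDominated c T (U n) (G n)) (hU : ∀ t, ∑' n, U n t ≠ ∞) :
    IsDominated c T (fun t => ∑' n, U n t) (fun x t ξ τ => ∑' n, G n x t ξ τ) where
  measurable := by
    refine measurable_of_tendsto_metrizable (f := fun N z =>
      ∑ n ∈ Finset.range N, Function.uncurry (causalCutoff T (G n)) z)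
      (fun N => Finset.measurable_fun_sum _ fun n _ => (h n).measurable)
      (tendsto_pi_nhds.2 fun ⟨p, q⟩ => ?_)
    by_cases hpq : (p, q) ∈ causal T
    · simp only [Function.uncurry_apply_pair, causalCutoff_of_mem hpq]
      exact (summable_norm h hU hpq).of_norm.hasSum.tendsto_sum_nat
    · simp only [Function.uncurry_apply_pair, causalCutoff_of_notMem hpq, Finset.sum_const_zero,
        tendsto_const_nhds]
  enorm_le _ _ hpq := enorm_tsum_le_tsum_enorm.trans (tsum_enorm_le h hpq)

lemma enorm_causalCutoff_le (h : IsDominated c T u G) (p q : ℝ × ℝ) :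
    ‖causalCutoff T G p q‖ₑ ≤ profileKernel c u p q := by
  by_cases hpq : (p, q) ∈ causal T
  · rw [causalCutoff_of_mem hpq]
    exact h.enorm_le p q hpq
  · rw [causalCutoff_of_notMem hpq, enorm_zero]
    exact zero_le

lemma enorm_causalCutoff_mul_le (h₁ : IsDominated c T u G₁) (h₂ : IsDominated c T v G₂)
    (p r q : ℝ × ℝ) : ‖causalCutoff T G₁ p r * causalCutoff T G₂ r q‖ₑ ≤
      profileKernel c u p r * profileKernel c v r q := by
  rw [enorm_mul]
  exact mul_le_mul' (h₁.enorm_causalCutoff_le p r) (h₂.enorm_causalCutoff_le r q)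

section Composition

variable (hc : 0 < c) (hu : Measurable u) (hv : Measurable v) (h₁ : IsDominated c T u G₁)
  (h₂ : IsDominated c T v G₂)

include hc hu hv h₁ h₂

lemma lintegral_enorm_causalCutoff_mul_le (p q : ℝ × ℝ) :
    ∫⁻ r, ‖causalCutoff T G₁ p r * causalCutoff T G₂ r q‖ₑ ≤
      profileKernel c (timeConv u v) p q := by
  rw [← lintegral_profileKernel_mul hc hu hv]
  exact lintegral_mono fun r => h₁.enorm_causalCutoff_mul_le h₂ p r q

lemma integrableOn_mul (hpq : (p, q) ∈ causal T) (htop : timeConv u v (p.2 - q.2) ≠ ∞) :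
    IntegrableOn (fun r : ℝ × ℝ => G₁ p.1 p.2 r.1 r.2 * G₂ r.1 r.2 q.1 q.2)
      (univ ×ˢ Ioo q.2 p.2) := by
  rw [← integrable_indicator_iff (by measurability), ← causalCutoff_mul_causalCutoff hpq]
  exact ⟨((h₁.measurable.comp measurable_prodMk_left).mul
    (h₂.measurable.comp measurable_prodMk_right)).aestronglyMeasurable,
    (lintegral_enorm_causalCutoff_mul_le hc hu hv h₁ h₂ p q).trans_lt
      (profileKernel_ne_top htop).lt_top⟩

lemma kernelConv_eq_integral (hpq : (p, q) ∈ causal T) (htop : timeConv u v (p.2 - q.2) ≠ ∞) :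
    kernelConv G₁ G₂ p.1 p.2 q.1 q.2 =
      ∫ r, causalCutoff T G₁ p r * causalCutoff T G₂ r q := by
  rw [causalCutoff_mul_causalCutoff hpq, integral_indicator (by measurability)]
  exact integral_integral_eq_setIntegral hpq.2.1.le
    (integrableOn_mul hc hu hv h₁ h₂ hpq htop)

protected lemma kernelConv (htop : ∀ s ∈ Ioc 0 T, timeConv u v s ≠ ∞) :
    IsDominated c T (timeConv u v) (kernelConv G₁ G₂) := by
  have htop' {p q : ℝ × ℝ} (hpq : (p, q) ∈ causal T) : timeConv u v (p.2 - q.2) ≠ ∞ :=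
    htop _ ⟨sub_pos.2 hpq.2.1, (sub_le_self _ hpq.1).trans hpq.2.2⟩
  refine ⟨?_, fun p q hpq => ?_⟩
  · have hmul : Measurable fun z : ((ℝ × ℝ) × (ℝ × ℝ)) × (ℝ × ℝ) =>
        causalCutoff T G₁ z.1.1 z.2 * causalCutoff T G₂ z.2 z.1.2 :=
      (h₁.measurable.comp (f := fun z : ((ℝ × ℝ) × (ℝ × ℝ)) × (ℝ × ℝ) => (z.1.1, z.2))
        (by fun_prop)).mul
      (h₂.measurable.comp (f := fun z : ((ℝ × ℝ) × (ℝ × ℝ)) × (ℝ × ℝ) => (z.2, z.1.2))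
        (by fun_prop))
    exact measurable_causalCutoff hmul.stronglyMeasurable.integral_prod_right'.measurable
      fun p q hpq => kernelConv_eq_integral hc hu hv h₁ h₂ hpq (htop' hpq)
  · rw [kernelConv_eq_integral hc hu hv h₁ h₂ hpq (htop' hpq)]
    exact (enorm_integral_le_lintegral_enorm _).trans
      (lintegral_enorm_causalCutoff_mul_le hc hu hv h₁ h₂ p q)

end Composition

end IsDominated

end Causal

/-! ### Differentiation of the composition -/

section Derivative

variable {c T : ℝ} {u v u' : ℝ → ℝ≥0∞} {G G₁ G₂ G' : ℝ → ℝ → ℝ → ℝ → ℝ} {t s τ : ℝ}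

namespace IsDominated

lemma measurable_source (h : IsDominated c T u G) (hs0 : 0 ≤ s) (hst : s < t) (htT : t ≤ T)
    (x : ℝ) : Measurable fun y => G x t y s := by
  convert h.measurable.comp (f := fun y => ((x, t), (y, s))) (by fun_prop) using 2 with y
  exact (causalCutoff_of_mem (p := (x, t)) (q := (y, s)) ⟨hs0, hst, htT⟩).symm

lemma measurable_target (h : IsDominated c T u G) (hs0 : 0 ≤ τ) (hst : τ < s) (htT : s ≤ T)
    (ξ : ℝ) : Measurable fun y => G y s ξ τ := by
  convert h.measurable.comp (f := fun y => ((y, s), (ξ, τ))) (by fun_prop) using 2 with y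
  exact (causalCutoff_of_mem (p := (y, s)) (q := (ξ, τ)) ⟨hs0, hst, htT⟩).symm

lemma norm_le (hc : 0 < c) (h : IsDominated c T u G) (hs0 : 0 ≤ s) (hst : s < t) (htT : t ≤ T)
    (hu : u (t - s) ≠ ∞) (x y : ℝ) : ‖G x t y s‖ ≤
      (u (t - s) * powerProfile (heatKernel c 0 1) (1 / 2) (t - s)).toReal := by
  rw [← toReal_enorm]
  refine ENNReal.toReal_mono (ENNReal.mul_ne_top hu (powerProfile_ne_top _ _ _)) ?_
  exact (h.enorm_le (x, t) (y, s) ⟨hs0, hst, htT⟩).trans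
    (mul_le_mul_right (ofReal_heatKernel_le hc (sub_pos.2 hst) _) _)

lemma integrable_target (hc : 0 < c) (h : IsDominated c T u G) (hτ0 : 0 ≤ τ) (hτs : τ < s)
    (hsT : s ≤ T) (hu : u (s - τ) ≠ ∞) (ξ : ℝ) : Integrable fun y => G y s ξ τ := by
  refine ⟨(h.measurable_target hτ0 hτs hsT ξ).aestronglyMeasurable, lt_of_le_of_lt ?_ hu.lt_top⟩
  calc ∫⁻ y, ‖G y s ξ τ‖ₑ ≤ ∫⁻ y, profileKernel c u (y, s) (ξ, τ) :=
        lintegral_mono fun y => h.enorm_le (y, s) (ξ, τ) ⟨hτ0, hτs, hsT⟩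
    _ = u (s - τ) := by
        simp only [profileKernel]
        rw [lintegral_const_mul _ (by fun_prop), lintegral_heatKernel_sub hc (sub_pos.2 hτs),
          mul_one]

lemma enorm_integral_mul_le (hc : 0 < c) (h₁ : IsDominated c T u G₁) (h₂ : IsDominated c T v G₂)
    (hτ0 : 0 ≤ τ) (hτs : τ < s) (hst : s < t) (htT : t ≤ T) (x ξ : ℝ) :
    ‖∫ y, G₁ x t y s * G₂ y s ξ τ‖ₑ ≤ u (t - s) * v (s - τ) *
      powerProfile (heatKernel c 0 1) (1 / 2) (t - τ) := by
  refine (enorm_integral_le_lintegral_enorm _).trans ?_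
  calc ∫⁻ y, ‖G₁ x t y s * G₂ y s ξ τ‖ₑ
      ≤ ∫⁻ y, profileKernel c u (x, t) (y, s) * profileKernel c v (y, s) (ξ, τ) :=
        lintegral_mono fun y => by
          rw [enorm_mul]
          exact mul_le_mul' (h₁.enorm_le (x, t) (y, s) ⟨hτ0.trans hτs.le, hst, htT⟩)
            (h₂.enorm_le (y, s) (ξ, τ) ⟨hτ0, hτs, hst.le.trans htT⟩)
    _ ≤ _ := by
        rw [lintegral_slice_profileKernel_mul hc,
          indicator_of_mem (show s ∈ Ioo τ t from ⟨hτs, hst⟩)]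
        gcongr
        exact ofReal_heatKernel_le hc (sub_pos.2 (hτs.trans hst)) _

variable (hc : 0 < c) (h₁ : IsDominated c T u G₁) (h' : IsDominated c T u' G')
  (h₂ : IsDominated c T v G₂)
  (hderiv : ∀ x t ξ τ, HasDerivAt (fun x => G₁ x t ξ τ) (G' x t ξ τ) x)
  (hu_top : ∀ s, u s ≠ ∞) (hu'_top : ∀ s, u' s ≠ ∞) (hv_top : ∀ s, v s ≠ ∞)

include hc h₁ h' h₂ hderiv hu_top hu'_top hv_top

lemma hasDerivAt_integral_mul (hτ0 : 0 ≤ τ) (hτs : τ < s) (hst : s < t) (htT : t ≤ T)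
    (x ξ : ℝ) : HasDerivAt (fun x => ∫ y, G₁ x t y s * G₂ y s ξ τ)
      (∫ y, G' x t y s * G₂ y s ξ τ) x := by
  have hs0 := hτ0.trans hτs.le
  have hG₂ := h₂.integrable_target hc hτ0 hτs (hst.le.trans htT) (hv_top _) ξ
  have hmeas (x : ℝ) : AEStronglyMeasurable fun y => G₁ x t y s * G₂ y s ξ τ :=
    (h₁.measurable_source hs0 hst htT x).aestronglyMeasurable.mul hG₂.aestronglyMeasurable
  have hint : Integrable fun y => G₁ x t y s * G₂ y s ξ τ :=
    (hG₂.norm.const_mul _).mono' (hmeas x) <| .of_forall fun y => (norm_mul_le _ _).trans <|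
      mul_le_mul_of_nonneg_right (h₁.norm_le hc hs0 hst htT (hu_top _) x y) (norm_nonneg _)
  exact (hasDerivAt_integral_of_dominated_loc_of_deriv_le (s := univ)
    (F' := fun x y => G' x t y s * G₂ y s ξ τ) Filter.univ_mem
    (.of_forall hmeas) hint
    ((h'.measurable_source hs0 hst htT x).aestronglyMeasurable.mul hG₂.aestronglyMeasurable)
    (.of_forall fun y z _ => (norm_mul_le _ _).trans <|
      mul_le_mul_of_nonneg_right (h'.norm_le hc hs0 hst htT (hu'_top _) z y) (norm_nonneg _))
    (hG₂.norm.const_mul _)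
    (.of_forall fun y z _ => (hderiv z t y s).mul_const (G₂ y s ξ τ))).2

/-- The derivative is first taken at a fixed intermediate time: the singularity in time of `G'` is
integrable only after integration in space. -/
lemma hasDerivAt_kernelConv (hu : Measurable u) (hu' : Measurable u') (hv : Measurable v)
    (hτ0 : 0 ≤ τ) (hτt : τ < t) (htT : t ≤ T) (htop : timeConv u v (t - τ) ≠ ∞)
    (htop' : timeConv u' v (t - τ) ≠ ∞) (x ξ : ℝ) :
    HasDerivAt (fun x => kernelConv G₁ G₂ x t ξ τ) (kernelConv G' G₂ x t ξ τ) x := by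
  have hint (x : ℝ) : IntegrableOn (fun s => ∫ y, G₁ x t y s * G₂ y s ξ τ) (Ioo τ t) :=
    integrableOn_integral <|
      h₁.integrableOn_mul hc hu hv h₂ (p := (x, t)) (q := (ξ, τ)) ⟨hτ0, hτt, htT⟩ htop
  have hint' : IntegrableOn (fun s => ∫ y, G' x t y s * G₂ y s ξ τ) (Ioo τ t) :=
    integrableOn_integral <|
      h'.integrableOn_mul hc hu' hv h₂ (p := (x, t)) (q := (ξ, τ)) ⟨hτ0, hτt, htT⟩ htop'
  have hbound : ∫⁻ s in Ioo τ t, u' (t - s) * v (s - τ) *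
      powerProfile (heatKernel c 0 1) (1 / 2) (t - τ) ≠ ∞ := by
    rw [lintegral_mul_const _ (by fun_prop), lintegral_Ioo_sub_eq_timeConv]
    exact ENNReal.mul_ne_top htop' (powerProfile_ne_top _ _ _)
  simp only [kernelConv, intervalIntegral.integral_of_le hτt.le, integral_Ioc_eq_integral_Ioo]
  refine (hasDerivAt_integral_of_dominated_loc_of_deriv_le (s := univ)
    (F' := fun x s => ∫ y, G' x t y s * G₂ y s ξ τ) Filter.univ_mem
    (.of_forall fun x => (hint x).aestronglyMeasurable) (hint x) hint'.aestronglyMeasurable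
    (ae_restrict_of_forall_mem measurableSet_Ioo fun s hs z _ => ?_)
    (integrable_toReal_of_lintegral_ne_top (Measurable.aemeasurable (by fun_prop)) hbound)
    (ae_restrict_of_forall_mem measurableSet_Ioo fun s hs z _ =>
      hasDerivAt_integral_mul hc h₁ h' h₂ hderiv hu_top hu'_top hv_top hτ0 hs.1 hs.2 htT z ξ)).2
  rw [← toReal_enorm]
  exact ENNReal.toReal_mono
    (ENNReal.mul_ne_top (ENNReal.mul_ne_top (hu'_top _) (hv_top _)) (powerProfile_ne_top _ _ _))
    (h'.enorm_integral_mul_le hc h₂ hτ0 hs.1 hs.2 htT z ξ)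

end IsDominated

end Derivative

/-! ### Bounds for the parametrix -/

/-- The coefficient `a` takes values in `[m, M]` on `ℝ × [0, T]` and is Hölder continuous there,
with constant `A` and exponent `α`. -/
structure IsHolderCoeff (m M : ℝ) (A α : ℝ≥0) (T : ℝ) (a : ℝ × ℝ → ℝ) : Prop where
  mem_Icc : ∀ p ∈ univ ×ˢ Icc 0 T, a p ∈ Icc m M
  holderOnWith : HolderOnWith A α a (univ ×ˢ Icc 0 T)

section Parametrix

variable {m M c k β γ T T₀ : ℝ} {A α : ℝ≥0} {a : ℝ × ℝ → ℝ} {G : ℝ → ℝ → ℝ → ℝ → ℝ}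
  {p q : ℝ × ℝ}

lemma target_mem_of_mem_causal (h : (p, q) ∈ causal T) : p ∈ univ ×ˢ Icc 0 T :=
  ⟨mem_univ _, h.1.trans h.2.1.le, h.2.2⟩

lemma source_mem_of_mem_causal (h : (p, q) ∈ causal T) : q ∈ univ ×ˢ Icc 0 T :=
  ⟨mem_univ _, h.1, h.2.1.le.trans h.2.2⟩

lemma IsHolderCoeff.measurable_indicator (ha : IsHolderCoeff m M A α T a) (hα : 0 < α) :
    Measurable ((univ ×ˢ Icc 0 T).indicator a) := by
  classical
  rw [← piecewise_eq_indicator]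
  exact (ha.holderOnWith.continuousOn hα).measurable_piecewise continuousOn_const
    (MeasurableSet.univ.prod measurableSet_Icc)

lemma IsDominated.of_abs_le {F : (ℝ × ℝ) × (ℝ × ℝ) → ℝ} (hF : Measurable F)
    (hGF : ∀ p q, (p, q) ∈ causal T → G p.1 p.2 q.1 q.2 = F (p, q)) (hk : 0 ≤ k)
    (hle : ∀ p q, (p, q) ∈ causal T → |G p.1 p.2 q.1 q.2| ≤
      k * (p.2 - q.2) ^ (-β) * heatKernel c (p.1 - q.1) (p.2 - q.2)) :
    IsDominated c T (powerProfile k β) G where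
  measurable := measurable_causalCutoff hF hGF
  enorm_le p q hpq := by
    have hpow : 0 ≤ (p.2 - q.2) ^ (-β) := Real.rpow_nonneg (sub_nonneg.2 hpq.2.1.le) _
    rw [Real.enorm_eq_ofReal_abs, profileKernel, powerProfile, ← ENNReal.ofReal_mul hk,
      ← ENNReal.ofReal_mul (mul_nonneg hk hpow)]
    exact ENNReal.ofReal_le_ofReal (hle p q hpq)

lemma exists_isDominated_frozenKernel (hm : 0 < m) (hmM : m ≤ M) (hα : 0 < α) :
    ∃ k : ℝ, 0 < k ∧ ∀ T (a : ℝ × ℝ → ℝ), IsHolderCoeff m M A α T a →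
      IsDominated (2 * M) T (powerProfile k 0) (frozenKernel a) := by
  obtain ⟨k, hk, hle⟩ := exists_heatKernel_le hm hmM
  refine ⟨k, hk, fun T a ha => ?_⟩
  have hmeas := ha.measurable_indicator hα
  refine .of_abs_le (F := fun z => heatKernel ((univ ×ˢ Icc 0 T).indicator a z.2)
    (z.1.1 - z.2.1) (z.1.2 - z.2.2)) (by fun_prop) (fun p q hpq => ?_) hk.le fun p q hpq => ?_
  · rw [indicator_of_mem (source_mem_of_mem_causal hpq), frozenKernel]
  · rw [frozenKernel, abs_of_nonneg (heatKernel_nonneg _ _ _), neg_zero, Real.rpow_zero, mul_one]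
    exact hle _ (ha.mem_Icc _ (source_mem_of_mem_causal hpq)) _ _ (sub_pos.2 hpq.2.1)

lemma exists_isDominated_frozenKernelX (hm : 0 < m) (hmM : m ≤ M) (hα : 0 < α) :
    ∃ k : ℝ, 0 < k ∧ ∀ T (a : ℝ × ℝ → ℝ), IsHolderCoeff m M A α T a →
      IsDominated (2 * M) T (powerProfile k (1 / 2)) (frozenKernelX a) := by
  obtain ⟨k, hk, hle⟩ := exists_abs_heatKernelX_le hm hmM
  refine ⟨k, hk, fun T a ha => ?_⟩
  have hmeas := ha.measurable_indicator hα
  refine .of_abs_le (F := fun z => heatKernelX ((univ ×ˢ Icc 0 T).indicator a z.2)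
    (z.1.1 - z.2.1) (z.1.2 - z.2.2)) (by fun_prop) (fun p q hpq => ?_) hk.le fun p q hpq => ?_
  · rw [indicator_of_mem (source_mem_of_mem_causal hpq), frozenKernelX]
  · exact hle _ (ha.mem_Icc _ (source_mem_of_mem_causal hpq)) _ _ (sub_pos.2 hpq.2.1)

lemma max_rpow_le {z d α : ℝ} (hd : 0 < d) (hdT : d ≤ T₀) (hα0 : 0 ≤ α) (hα1 : α ≤ 1) :
    (max |z| d) ^ α ≤ (1 + T₀) * d ^ (α / 2) * (1 + z ^ 2 / d) := by
  have hmax : 0 ≤ max |z| d := le_max_of_le_right hd.le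
  have hr : 0 ≤ z ^ 2 / d := by positivity
  have hT : 0 < T₀ := hd.trans_le hdT
  have hsq : (max |z| d) ^ 2 ≤ d * ((1 + T₀) * (1 + z ^ 2 / d)) := by
    have hexpand : d * ((1 + T₀) * (1 + z ^ 2 / d)) = (1 + T₀) * (d + z ^ 2) := by
      field_simp
    rw [hexpand]
    rcases max_cases |z| d with ⟨h, -⟩ | ⟨h, -⟩ <;> rw [h]
    · rw [sq_abs]
      nlinarith [sq_nonneg z]
    · nlinarith [sq_nonneg z]
  have hone : 1 ≤ (1 + T₀) * (1 + z ^ 2 / d) := by nlinarith [mul_nonneg hT.le hr]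
  calc (max |z| d) ^ α = ((max |z| d) ^ 2) ^ (α / 2) := by
        rw [← Real.rpow_natCast, ← Real.rpow_mul hmax]
        ring_nf
    _ ≤ (d * ((1 + T₀) * (1 + z ^ 2 / d))) ^ (α / 2) := by gcongr
    _ = d ^ (α / 2) * ((1 + T₀) * (1 + z ^ 2 / d)) ^ (α / 2) :=
        Real.mul_rpow hd.le (by positivity)
    _ ≤ d ^ (α / 2) * ((1 + T₀) * (1 + z ^ 2 / d)) := by
        gcongr
        exact Real.rpow_le_self_of_one_le hone (by linarith)
    _ = _ := by ring

lemma IsHolderCoeff.abs_sub_le (ha : IsHolderCoeff m M A α T a) (hα : α ≤ 1) (hT : T ≤ T₀)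
    (hpq : (p, q) ∈ causal T) : |a p - a q| ≤ A * (1 + T₀) * (p.2 - q.2) ^ (α / 2 : ℝ) *
      (1 + (p.1 - q.1) ^ 2 / (p.2 - q.2)) := by
  have hd : 0 < p.2 - q.2 := sub_pos.2 hpq.2.1
  have hdT : p.2 - q.2 ≤ T₀ := ((sub_le_self _ hpq.1).trans hpq.2.2).trans hT
  calc |a p - a q| ≤ A * dist p q ^ (α : ℝ) := ha.holderOnWith.dist_le
        (target_mem_of_mem_causal hpq) (source_mem_of_mem_causal hpq)
    _ = A * max |p.1 - q.1| (p.2 - q.2) ^ (α : ℝ) := by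
        rw [Prod.dist_eq, Real.dist_eq, Real.dist_eq, abs_of_pos hd]
    _ ≤ A * ((1 + T₀) * (p.2 - q.2) ^ (α / 2 : ℝ) * (1 + (p.1 - q.1) ^ 2 / (p.2 - q.2))) := by
        gcongr
        exact max_rpow_le hd hdT α.coe_nonneg (mod_cast hα)
    _ = _ := by ring

/-- The Hölder continuity of the coefficient takes `α / 2` off the singularity of `∂ₓₓ H`. -/
lemma exists_isDominated_sub_mul_heatKernelXX (hm : 0 < m) (hmM : m ≤ M) (hα : 0 < α)
    (hα1 : α ≤ 1) (hT₀ : 0 < T₀) :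
    ∃ k : ℝ, 0 ≤ k ∧ ∀ T ≤ T₀, ∀ a : ℝ × ℝ → ℝ, IsHolderCoeff m M A α T a →
      IsDominated (2 * M) T (powerProfile k (1 - α / 2)) fun x t ξ τ =>
        (a (x, t) - a (ξ, τ)) * heatKernelXX (a (ξ, τ)) (x - ξ) (t - τ) := by
  obtain ⟨k, hk, hle⟩ := exists_mul_abs_heatKernelXX_le hm hmM
  refine ⟨A * (1 + T₀) * k, by positivity, fun T hT a ha => ?_⟩
  have hmeas := ha.measurable_indicator hα
  refine .of_abs_le (F := fun z => ((univ ×ˢ Icc 0 T).indicator a z.1 -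
    (univ ×ˢ Icc 0 T).indicator a z.2) * heatKernelXX ((univ ×ˢ Icc 0 T).indicator a z.2)
    (z.1.1 - z.2.1) (z.1.2 - z.2.2)) (by fun_prop) (fun p q hpq => ?_) (by positivity)
    fun p q hpq => ?_
  · rw [indicator_of_mem (source_mem_of_mem_causal hpq),
      indicator_of_mem (target_mem_of_mem_causal hpq)]
  · have hd : 0 < p.2 - q.2 := sub_pos.2 hpq.2.1
    rw [abs_mul]
    calc _ ≤ A * (1 + T₀) * (p.2 - q.2) ^ (α / 2 : ℝ) * (1 + (p.1 - q.1) ^ 2 / (p.2 - q.2)) *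
          |heatKernelXX (a q) (p.1 - q.1) (p.2 - q.2)| := by
          gcongr
          exact ha.abs_sub_le hα1 hT hpq
      _ = A * (1 + T₀) * (p.2 - q.2) ^ (α / 2 : ℝ) * ((1 + (p.1 - q.1) ^ 2 / (p.2 - q.2)) *
          |heatKernelXX (a q) (p.1 - q.1) (p.2 - q.2)|) := by ring
      _ ≤ A * (1 + T₀) * (p.2 - q.2) ^ (α / 2 : ℝ) *
          (k * (p.2 - q.2)⁻¹ * heatKernel (2 * M) (p.1 - q.1) (p.2 - q.2)) :=
          mul_le_mul_of_nonneg_left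
            (hle _ (ha.mem_Icc _ (source_mem_of_mem_causal hpq)) _ _ hd) (by positivity)
      _ = _ := by
          rw [neg_sub, Real.rpow_sub hd, Real.rpow_one]
          ring

lemma exists_isDominated_parametrixError (hm : 0 < m) (hmM : m ≤ M) (hα : 0 < α) (hα1 : α ≤ 1)
    (γ : ℝ) (hT₀ : 0 < T₀) :
    ∃ k : ℝ, 0 < k ∧ ∀ T ≤ T₀, ∀ a : ℝ × ℝ → ℝ, IsHolderCoeff m M A α T a →
      IsDominated (2 * M) T (powerProfile k (1 - α / 2)) (parametrixError a γ) := by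
  obtain ⟨k₁, hk₁, hprincipal⟩ :=
    exists_isDominated_sub_mul_heatKernelXX (A := A) hm hmM hα hα1 hT₀
  obtain ⟨k₂, hk₂, hfrozen⟩ := exists_isDominated_frozenKernel (A := A) hm hmM hα
  have hβ : (0 : ℝ) ≤ 1 - α / 2 := by
    have : (α : ℝ) ≤ 1 := mod_cast hα1
    linarith
  refine ⟨k₁ + |γ| * k₂ * T₀ ^ (1 - α / 2 - 0 : ℝ) + 1, by positivity, fun T hT a ha => ?_⟩
  refine (((hprincipal T hT a ha).add ((hfrozen T a ha).const_mul (-γ))).congr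
    fun p q hpq => ?_).mono fun s hs => ?_
  · have hpos := hm.trans_le (ha.mem_Icc _ (source_mem_of_mem_causal hpq)).1
    rw [parametrixError_eq hpos hpq.2.1, frozenKernel, neg_mul, sub_eq_add_neg]
  · calc powerProfile k₁ (1 - α / 2) s + ‖-γ‖ₑ * powerProfile k₂ 0 s
        = powerProfile k₁ (1 - α / 2) s + powerProfile (|γ| * k₂) 0 s := by
          rw [enorm_neg, Real.enorm_eq_ofReal_abs, powerProfile, powerProfile, powerProfile,
            ENNReal.ofReal_mul (abs_nonneg γ), mul_assoc]
      _ ≤ powerProfile k₁ (1 - α / 2) s +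
            powerProfile (|γ| * k₂ * T₀ ^ (1 - α / 2 - 0 : ℝ)) (1 - α / 2) s := by
          gcongr
          exact powerProfile_le_of_exponent_le (by positivity) hβ hs.1 (hs.2.trans hT)
      _ ≤ _ := by
          rw [← powerProfile_add hk₁ (by positivity)]
          exact powerProfile_le (le_add_of_nonneg_right zero_le_one)

end Parametrix

/-! ### The Neumann series -/

/-- Gaussian bounds on all the kernels of the parametrix construction, with one constant `k`; the
singularity of the iterated kernels is of order `β`. -/
structure HasParametrixBounds (c T k β : ℝ) (a : ℝ × ℝ → ℝ) (γ : ℝ) : Prop where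
  frozenKernel : IsDominated c T (powerProfile k 0) (frozenKernel a)
  frozenKernelX : IsDominated c T (powerProfile k (1 / 2)) (frozenKernelX a)
  iteratedError : ∀ n, IsDominated c T (powerProfile k β) (iteratedError a γ n)
  summable : ∀ p q, (p, q) ∈ causal T →
    Summable fun n => ‖ParabolicKernel.iteratedError a γ n p.1 p.2 q.1 q.2‖
  density : IsDominated c T (powerProfile k β) (density a γ)

section Neumann

variable {m M c k k' α β γ l t T T₀ : ℝ} {a : ℝ × ℝ → ℝ}

lemma timeConv_powerProfile_ne_top (hk : 0 ≤ k) (hk' : 0 ≤ k') (hα : α < 1) (hβ : β < 1)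
    (ht : 0 < t) : timeConv (powerProfile k α) (powerProfile k' β) t ≠ ∞ := by
  rw [timeConv_powerProfile hk hk' hα hβ ht]
  exact powerProfile_ne_top _ _ _

lemma tsum_expProfile_div_two_pow (hk : 0 ≤ k) (β l t : ℝ) :
    ∑' n : ℕ, expProfile (k / 2 ^ n) β l t = expProfile (2 * k) β l t := by
  simp only [expProfile, powerProfile, ENNReal.tsum_mul_right]
  rw [← ENNReal.ofReal_tsum_of_nonneg (fun n => by positivity)
    (by simpa using summable_geometric_two' (2 * k))]
  congr 3
  simpa using tsum_geometric_two' (2 * k)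

lemma expProfile_le_powerProfile (hkk' : k ≤ k') (hl : 0 ≤ l) (htT₀ : t ≤ T₀) (β : ℝ) :
    expProfile k β l t ≤ powerProfile (k' * Real.exp (l * T₀)) β t := by
  rw [expProfile, powerProfile, powerProfile, ENNReal.ofReal_mul' (Real.exp_nonneg _),
    mul_right_comm]
  gcongr

lemma exists_isDominated_iteratedError (hc : 0 < c) (hk : 0 < k) (hβ0 : 0 ≤ β) (hβ : β < 1)
    (hT₀ : 0 < T₀) :
    ∃ l : ℝ, 0 < l ∧ ∀ T ≤ T₀, ∀ (a : ℝ × ℝ → ℝ) (γ : ℝ),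
      IsDominated c T (powerProfile k β) (parametrixError a γ) →
        ∀ n, IsDominated c T (expProfile (k / 2 ^ n) β l) (iteratedError a γ n) := by
  obtain ⟨l, hl, hcontract⟩ := exists_timeConv_expProfile_le hk hβ0 hβ hT₀
  refine ⟨l, hl, fun T hT a γ herror n => ?_⟩
  induction n with
  | zero =>
    refine herror.mono fun s hs => ?_
    rw [expProfile, pow_zero, div_one]
    refine le_mul_of_one_le_right zero_le ?_
    rw [ENNReal.one_le_ofReal]
    exact Real.one_le_exp (mul_nonneg hl.le hs.1.le)
  | succ n ih =>
    have hle : ∀ s ∈ Ioc 0 T, timeConv (powerProfile k β) (expProfile (k / 2 ^ n) β l) s ≤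
        expProfile (k / 2 ^ (n + 1)) β l s := fun s hs => by
      rw [pow_succ, ← div_div]
      exact hcontract _ s (by positivity) hs.1 (hs.2.trans hT)
    exact (IsDominated.kernelConv hc (by fun_prop) (by fun_prop) herror ih fun s hs =>
      ne_top_of_le_ne_top (expProfile_ne_top _ _ _ _) (hle s hs)).mono hle

lemma exists_isDominated_density (hc : 0 < c) (hk : 0 < k) (hβ0 : 0 ≤ β) (hβ : β < 1)
    (hT₀ : 0 < T₀) :
    ∃ k' : ℝ, 0 < k' ∧ ∀ T ≤ T₀, ∀ (a : ℝ × ℝ → ℝ) (γ : ℝ),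
      IsDominated c T (powerProfile k β) (parametrixError a γ) →
        (∀ n, IsDominated c T (powerProfile k' β) (iteratedError a γ n)) ∧
        (∀ p q, (p, q) ∈ causal T →
          Summable fun n => ‖iteratedError a γ n p.1 p.2 q.1 q.2‖) ∧
        IsDominated c T (powerProfile k' β) (density a γ) := by
  obtain ⟨l, hl, hiter⟩ := exists_isDominated_iteratedError hc hk hβ0 hβ hT₀
  refine ⟨2 * k * Real.exp (l * T₀), by positivity, fun T hT a γ herror => ?_⟩
  have hdom := hiter T hT a γ herror
  have hsum (t : ℝ) := tsum_expProfile_div_two_pow hk.le β l t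
  have htop (t : ℝ) : ∑' n : ℕ, expProfile (k / 2 ^ n) β l t ≠ ∞ := by
    rw [hsum]
    exact expProfile_ne_top _ _ _ _
  refine ⟨fun n => (hdom n).mono fun s hs => expProfile_le_powerProfile ?_ hl.le (hs.2.trans hT) β,
    fun p q hpq => IsDominated.summable_norm hdom htop hpq,
    (IsDominated.tsum hdom htop).mono fun s hs => ?_⟩
  · exact (div_le_self hk.le (one_le_pow₀ one_le_two)).trans (by linarith)
  · rw [hsum]
    exact expProfile_le_powerProfile le_rfl hl.le (hs.2.trans hT) β

lemma exists_hasParametrixBounds {A α : ℝ≥0} (hm : 0 < m) (hmM : m ≤ M) (hα : 0 < α)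
    (hα1 : α ≤ 1) (γ : ℝ) (hT₀ : 0 < T₀) :
    ∃ k : ℝ, 0 < k ∧ ∀ T ≤ T₀, ∀ a : ℝ × ℝ → ℝ, IsHolderCoeff m M A α T a →
      HasParametrixBounds (2 * M) T k (1 - α / 2) a γ := by
  have hc : 0 < 2 * M := by linarith
  have : (0 : ℝ) < α := mod_cast hα
  have : (α : ℝ) ≤ 1 := mod_cast hα1
  obtain ⟨k₁, hk₁, hfrozen⟩ := exists_isDominated_frozenKernel (A := A) hm hmM hα
  obtain ⟨k₂, hk₂, hfrozenX⟩ := exists_isDominated_frozenKernelX (A := A) hm hmM hα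
  obtain ⟨k₃, hk₃, herror⟩ := exists_isDominated_parametrixError (A := A) hm hmM hα hα1 γ hT₀
  obtain ⟨k₄, hk₄, hdensity⟩ := exists_isDominated_density (β := 1 - α / 2) hc hk₃
    (by linarith) (by linarith) hT₀
  refine ⟨k₁ + k₂ + k₄, by positivity, fun T hT a ha => ?_⟩
  obtain ⟨hiter, hsummable, hdens⟩ := hdensity T hT a γ (herror T hT a ha)
  exact
    { frozenKernel := (hfrozen T a ha).mono fun _ _ => powerProfile_le (by linarith)
      frozenKernelX := (hfrozenX T a ha).mono fun _ _ => powerProfile_le (by linarith)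
      iteratedError := fun n => (hiter n).mono fun _ _ => powerProfile_le (by linarith)
      summable := hsummable
      density := hdens.mono fun _ _ => powerProfile_le (by linarith) }

lemma exists_isDominated_add_kernelConv (hc : 0 < c) (hk : 0 < k) (hk' : 0 < k') (hα : α < 1)
    (hβ : β < 1) (hT₀ : 0 < T₀) :
    ∃ C : ℝ, 0 < C ∧ ∀ T ≤ T₀, ∀ G₁ G₂ : ℝ → ℝ → ℝ → ℝ → ℝ,
      IsDominated c T (powerProfile k α) G₁ → IsDominated c T (powerProfile k' β) G₂ →
        IsDominated c T (powerProfile C α)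
          fun x t ξ τ => G₁ x t ξ τ + kernelConv G₁ G₂ x t ξ τ := by
  set B := ProbabilityTheory.beta (1 - β) (1 - α)
  have hB : 0 < B := ProbabilityTheory.beta_pos (by linarith) (by linarith)
  refine ⟨k + k * k' * B * T₀ ^ (α - (α + β - 1)), by positivity, fun T hT G₁ G₂ h₁ h₂ => ?_⟩
  refine (h₁.add (IsDominated.kernelConv hc (by fun_prop) (by fun_prop) h₁ h₂ fun s hs =>
    timeConv_powerProfile_ne_top hk.le hk'.le hα hβ hs.1)).mono fun s hs => ?_
  rw [timeConv_powerProfile hk.le hk'.le hα hβ hs.1, powerProfile_add hk.le (by positivity)]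
  gcongr
  exact powerProfile_le_of_exponent_le (by positivity) (by linarith) hs.1 (hs.2.trans hT)

namespace HasParametrixBounds

variable (hc : 0 < c) (hk : 0 ≤ k) (hβ : β < 1) (h : HasParametrixBounds c T k β a γ)

include hc hk hβ h

lemma hasDerivAt_Gam {τ : ℝ} (hτ0 : 0 ≤ τ) (hτt : τ < t) (htT : t ≤ T) (x ξ : ℝ) :
    HasDerivAt (fun x => Gam a γ x t ξ τ) (ParabolicKernel.frozenKernelX a x t ξ τ +
      kernelConv (ParabolicKernel.frozenKernelX a) (ParabolicKernel.density a γ) x t ξ τ) x :=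
  (hasDerivAt_frozenKernel a x t ξ τ).add <|
    IsDominated.hasDerivAt_kernelConv hc h.frozenKernel h.frozenKernelX h.density
      (hasDerivAt_frozenKernel a) (powerProfile_ne_top _ _) (powerProfile_ne_top _ _)
      (powerProfile_ne_top _ _) (by fun_prop) (by fun_prop) (by fun_prop) hτ0 hτt htT
      (timeConv_powerProfile_ne_top hk hk one_pos hβ (sub_pos.2 hτt))
      (timeConv_powerProfile_ne_top hk hk one_half_lt_one hβ (sub_pos.2 hτt)) x ξ

lemma wellDefined : WellDefined a γ T where
  iterated x t ξ τ hτ0 hτt htT n :=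
    IsDominated.integrableOn_mul hc (by fun_prop) (by fun_prop) (h.iteratedError 0)
      (h.iteratedError n) (p := (x, t)) (q := (ξ, τ)) ⟨hτ0, hτt, htT⟩
      (timeConv_powerProfile_ne_top hk hk hβ hβ (sub_pos.2 hτt))
  series x t ξ τ hτ0 hτt htT := h.summable (x, t) (ξ, τ) ⟨hτ0, hτt, htT⟩
  correction x t ξ τ hτ0 hτt htT :=
    IsDominated.integrableOn_mul hc (by fun_prop) (by fun_prop) h.frozenKernel h.density
      (p := (x, t)) (q := (ξ, τ)) ⟨hτ0, hτt, htT⟩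
      (timeConv_powerProfile_ne_top hk hk one_pos hβ (sub_pos.2 hτt))
  differentiable x t ξ τ hτ0 hτt htT :=
    (h.hasDerivAt_Gam hc hk hβ hτ0 hτt htT x ξ).differentiableAt

end HasParametrixBounds

theorem exists_isDominated_Gam_GamX {A α : ℝ≥0} (hm : 0 < m) (hmM : m ≤ M) (hα : 0 < α)
    (hα1 : α ≤ 1) (γ : ℝ) (hT₀ : 0 < T₀) :
    ∃ k : ℝ, 0 < k ∧ ∀ T ≤ T₀, ∀ a : ℝ × ℝ → ℝ, IsHolderCoeff m M A α T a →
      WellDefined a γ T ∧ IsDominated (2 * M) T (powerProfile k 0) (Gam a γ) ∧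
        IsDominated (2 * M) T (powerProfile k (1 / 2)) (GamX a γ) := by
  have hc : 0 < 2 * M := by linarith
  have hβ : (1 - α / 2 : ℝ) < 1 := by
    have : (0 : ℝ) < α := mod_cast hα
    linarith
  obtain ⟨k, hk, hbounds⟩ := exists_hasParametrixBounds (A := A) hm hmM hα hα1 γ hT₀
  obtain ⟨k₁, hk₁, hGam⟩ := exists_isDominated_add_kernelConv hc hk hk one_pos hβ hT₀
  obtain ⟨k₂, hk₂, hGamX⟩ := exists_isDominated_add_kernelConv hc hk hk one_half_lt_one hβ hT₀
  refine ⟨k₁ + k₂, by positivity, fun T hT a ha => ?_⟩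
  have h := hbounds T hT a ha
  refine ⟨h.wellDefined hc hk.le hβ,
    (hGam T hT _ _ h.frozenKernel h.density).mono fun _ _ => powerProfile_le (by linarith),
    ((hGamX T hT _ _ h.frozenKernelX h.density).congr fun p q hpq => ?_).mono
      fun _ _ => powerProfile_le (by linarith)⟩
  exact (h.hasDerivAt_Gam hc hk.le hβ hpq.1 hpq.2.1 hpq.2.2 p.1 q.1).deriv

end Neumann

/-! ### Duhamel integrals -/

/-- The Volterra operator `f ↦ ∫₀ᵗ ∫ G(x, t; ξ, τ) f(ξ, τ) dξ dτ` with kernel `G`; `duhamel` and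
`duhamelX` are the cases `G = Γ` and `G = Γₓ`. -/
noncomputable def duhamelOp (G : ℝ → ℝ → ℝ → ℝ → ℝ) (f : ℝ × ℝ → ℝ) (p : ℝ × ℝ) : ℝ :=
  ∫ τ in (0 : ℝ)..p.2, ∫ ξ, G p.1 p.2 ξ τ * f (ξ, τ)

/-- The extension by zero of a function on `Ω_T`. -/
noncomputable def zeroExt (T : ℝ) (f : ℝ × ℝ → ℝ) : ℝ × ℝ → ℝ :=
  (univ ×ˢ Ioc 0 T).indicator f

/-- The upper bound for `∫₀ᵗ ∫ |G(x, t; ξ, τ) f(ξ, τ)| dξ dτ` obtained from the bound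
`|G(x, t; ξ, τ)| ≤ u(t - τ) H(x - ξ, t - τ)`; only the values of `u` on `(0, T]` matter. -/
noncomputable def duhamelMajorant (c T : ℝ) (u : ℝ → ℝ≥0∞) (f : ℝ × ℝ → ℝ) (p : ℝ × ℝ) : ℝ≥0∞ :=
  ∫⁻ q, profileKernel c ((Iic T).indicator u) p q * ‖zeroExt T f q‖ₑ

section Duhamel

variable {c T : ℝ} {u : ℝ → ℝ≥0∞} {G : ℝ → ℝ → ℝ → ℝ → ℝ} {f : ℝ × ℝ → ℝ} {p : ℝ × ℝ}

lemma eLpNorm_two_sq {α : Type*} [MeasurableSpace α] {μ : Measure α} (f : α → ℝ) :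
    eLpNorm f 2 μ ^ 2 = ∫⁻ x, ‖f x‖ₑ ^ 2 ∂μ := by
  have h := eLpNorm_nnreal_pow_eq_lintegral (f := f) (μ := μ) (p := 2) two_ne_zero
  simpa only [NNReal.coe_ofNat, ENNReal.rpow_ofNat, ENNReal.coe_ofNat] using h

lemma measurableSet_strip (T : ℝ) : MeasurableSet ((univ : Set ℝ) ×ˢ Ioc 0 T) :=
  MeasurableSet.univ.prod measurableSet_Ioc

lemma ae_stripMeasure_mem (T : ℝ) : ∀ᵐ p ∂stripMeasure T, 0 < p.2 ∧ p.2 ≤ T := by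
  filter_upwards [ae_restrict_mem (measurableSet_strip T)] with p hp using hp.2

lemma aestronglyMeasurable_zeroExt (hf : AEStronglyMeasurable f (stripMeasure T)) :
    AEStronglyMeasurable (zeroExt T f) :=
  (aestronglyMeasurable_indicator_iff (measurableSet_strip T)).2 hf

lemma eLpNorm_zeroExt (T : ℝ) (f : ℝ × ℝ → ℝ) (r : ℝ≥0∞) :
    eLpNorm (zeroExt T f) r = eLpNorm f r (stripMeasure T) :=
  eLpNorm_indicator_eq_eLpNorm_restrict (measurableSet_strip T)

lemma ae_eLpNorm_zeroExt_slice_le (T : ℝ) (f : ℝ × ℝ → ℝ) :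
    ∀ᵐ s : ℝ, eLpNorm (fun y => zeroExt T f (y, s)) 2 ≤ normLinfL2 T f := by
  have hsup := (ae_restrict_iff' measurableSet_Ioo).1 <|
    ae_le_essSup (f := fun t => eLpNorm (fun x => f (x, t)) 2)
      (μ := (volume : Measure ℝ).restrict (Ioo 0 T))
  filter_upwards [hsup, Measure.ae_ne volume T] with s hs hsT
  by_cases hmem : s ∈ Ioc 0 T
  · have hslice : (fun y => zeroExt T f (y, s)) = fun y => f (y, s) :=
      funext fun y => indicator_of_mem (mk_mem_prod (mem_univ y) hmem) f
    rw [hslice]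
    exact hs ⟨hmem.1, hmem.2.lt_of_ne hsT⟩
  · have hslice : (fun y => zeroExt T f (y, s)) = 0 :=
      funext fun y => indicator_of_notMem (fun h => hmem h.2) f
    rw [hslice, eLpNorm_zero]
    exact zero_le

lemma causalCutoff_mul_zeroExt (hp : p.2 ≤ T) (G : ℝ → ℝ → ℝ → ℝ → ℝ) (f : ℝ × ℝ → ℝ) :
    (fun q => causalCutoff T G p q * zeroExt T f q) =
      (univ ×ˢ Ioo 0 p.2).indicator (fun q => G p.1 p.2 q.1 q.2 * f q) := by
  ext q
  by_cases hq : q ∈ univ ×ˢ Ioo 0 p.2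
  · rw [indicator_of_mem hq, causalCutoff_of_mem ⟨hq.2.1.le, hq.2.2, hp⟩, zeroExt,
      indicator_of_mem (mk_mem_prod hq.1 (mem_Ioc.2 ⟨hq.2.1, hq.2.2.le.trans hp⟩))]
  · rw [indicator_of_notMem hq, mul_eq_zero]
    by_contra! hne
    exact hq ⟨mem_univ _, (mem_of_indicator_ne_zero hne.2).2.1,
      (not_not.1 (mt causalCutoff_of_notMem hne.1)).2.1⟩

lemma lintegral_Ioi_indicator_Iic (T : ℝ) (u : ℝ → ℝ≥0∞) :
    ∫⁻ s in Ioi 0, (Iic T).indicator u s = ∫⁻ s in Ioc 0 T, u s := by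
  rw [setLIntegral_indicator measurableSet_Iic, inter_comm, Ioi_inter_Iic]

lemma sq_duhamelMajorant_le (hc : 0 < c) (hu : Measurable u)
    (hf : AEStronglyMeasurable f (stripMeasure T)) (p : ℝ × ℝ) :
    duhamelMajorant c T u f p ^ 2 ≤
      (∫⁻ s in Ioc 0 T, u s ^ 2 * powerProfile (heatKernel c 0 1) (1 / 2) s) *
        eLpNorm f 2 (stripMeasure T) ^ 2 := by
  have hprofile (s : ℝ) : (Iic T).indicator
      (fun s => u s ^ 2 * powerProfile (heatKernel c 0 1) (1 / 2) s) s =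
      (Iic T).indicator u s ^ 2 * powerProfile (heatKernel c 0 1) (1 / 2) s := by
    by_cases hs : s ∈ Iic T
    · rw [indicator_of_mem hs, indicator_of_mem hs]
    · rw [indicator_of_notMem hs, indicator_of_notMem hs, zero_pow two_ne_zero, zero_mul]
  rw [← eLpNorm_zeroExt, eLpNorm_two_sq, ← lintegral_Ioi_indicator_Iic]
  simp_rw [hprofile]
  exact sq_lintegral_profileKernel_mul_le hc (hu.indicator measurableSet_Iic)
    (aestronglyMeasurable_zeroExt hf).enorm p

lemma duhamelMajorant_le_mul_normLinfL2 (hc : 0 < c) (hu : Measurable u)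
    (hf : AEStronglyMeasurable f (stripMeasure T)) (p : ℝ × ℝ) :
    duhamelMajorant c T u f p ≤
      (∫⁻ s in Ioc 0 T, u s * powerProfile (√(heatKernel c 0 1)) (1 / 4) s) *
        normLinfL2 T f := by
  rw [← lintegral_Ioi_indicator_Iic]
  simp_rw [indicator_mul_left]
  refine lintegral_profileKernel_mul_le_of_slice hc (hu.indicator measurableSet_Iic)
    (aestronglyMeasurable_zeroExt hf).enorm ?_ p
  filter_upwards [ae_eLpNorm_zeroExt_slice_le T f] with s hs
  rw [← eLpNorm_two_sq]
  exact pow_le_pow_left' hs 2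

lemma lintegral_duhamelMajorant_sq_le (hc : 0 < c) (hu : Measurable u)
    (hf : AEStronglyMeasurable f (stripMeasure T)) :
    ∫⁻ p, duhamelMajorant c T u f p ^ 2 ≤
      ((∫⁻ s in Ioc 0 T, u s) * eLpNorm f 2 (stripMeasure T)) ^ 2 := by
  have huT : Measurable ((Iic T).indicator u) := hu.indicator measurableSet_Iic
  rw [mul_pow, ← eLpNorm_zeroExt, eLpNorm_two_sq, sq,
    ← lintegral_Ioi_indicator_Iic]
  exact lintegral_sq_le_of_schur_test (by unfold Function.uncurry; fun_prop)
    (aestronglyMeasurable_zeroExt hf).enorm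
    (fun p => (lintegral_profileKernel_right hc huT p).le)
    (fun q => (lintegral_profileKernel_left hc huT q).le)

lemma aemeasurable_duhamelMajorant (c : ℝ) (hu : Measurable u)
    (hf : AEStronglyMeasurable f (stripMeasure T)) : AEMeasurable (duhamelMajorant c T u f) := by
  have huT : Measurable ((Iic T).indicator u) := hu.indicator measurableSet_Iic
  have hkernel : Measurable fun z : (ℝ × ℝ) × (ℝ × ℝ) =>
      profileKernel c ((Iic T).indicator u) z.1 z.2 := by fun_prop
  exact (hkernel.aemeasurable.fun_mul
    (aestronglyMeasurable_zeroExt hf).enorm.comp_snd).lintegral_prod_right'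

lemma ae_duhamelMajorant_ne_top (hc : 0 < c) (hu : Measurable u)
    (hutop : ∫⁻ s in Ioc 0 T, u s ≠ ∞) (hf : MemLp f 2 (stripMeasure T)) :
    ∀ᵐ p, duhamelMajorant c T u f p ≠ ∞ := by
  have hfin : ∫⁻ p, duhamelMajorant c T u f p ^ 2 ≠ ∞ :=
    ne_top_of_le_ne_top (ENNReal.pow_ne_top (ENNReal.mul_ne_top hutop hf.2.ne))
      (lintegral_duhamelMajorant_sq_le hc hu hf.1)
  filter_upwards [ae_lt_top' ((aemeasurable_duhamelMajorant c hu hf.1).pow_const 2) hfin]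
    with p hp htop
  simp [htop] at hp

namespace IsDominated

section Pointwise

variable (h : IsDominated c T u G)

include h

lemma lintegral_enorm_causalCutoff_mul_zeroExt_le (f : ℝ × ℝ → ℝ) (p : ℝ × ℝ) :
    ∫⁻ q, ‖causalCutoff T G p q * zeroExt T f q‖ₑ ≤ duhamelMajorant c T u f p := by
  refine lintegral_mono fun q => ?_
  rw [enorm_mul]
  gcongr
  exact (h.mono fun s hs => (indicator_of_mem (mem_Iic.2 hs.2) u).ge).enorm_causalCutoff_le p q

lemma integrableOn_mul_of_duhamelMajorant_ne_top (hf : AEStronglyMeasurable f (stripMeasure T))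
    (hp : p.2 ≤ T) (htop : duhamelMajorant c T u f p ≠ ∞) :
    IntegrableOn (fun q => G p.1 p.2 q.1 q.2 * f q) (univ ×ˢ Ioo 0 p.2) := by
  rw [← integrable_indicator_iff (by measurability), ← causalCutoff_mul_zeroExt hp]
  exact ⟨(h.measurable.comp measurable_prodMk_left).aestronglyMeasurable.mul
      (aestronglyMeasurable_zeroExt hf),
    (h.lintegral_enorm_causalCutoff_mul_zeroExt_le f p).trans_lt htop.lt_top⟩

lemma duhamelOp_eq_integral (hf : AEStronglyMeasurable f (stripMeasure T)) (hp0 : 0 ≤ p.2)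
    (hp : p.2 ≤ T) (htop : duhamelMajorant c T u f p ≠ ∞) :
    duhamelOp G f p = ∫ q, causalCutoff T G p q * zeroExt T f q := by
  rw [causalCutoff_mul_zeroExt hp, integral_indicator (by measurability)]
  exact integral_integral_eq_setIntegral hp0
    (h.integrableOn_mul_of_duhamelMajorant_ne_top hf hp htop)

lemma enorm_duhamelOp_le (hf : AEStronglyMeasurable f (stripMeasure T)) (hp0 : 0 ≤ p.2)
    (hp : p.2 ≤ T) : ‖duhamelOp G f p‖ₑ ≤ duhamelMajorant c T u f p := by
  by_cases htop : duhamelMajorant c T u f p = ∞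
  · exact htop ▸ le_top
  · rw [h.duhamelOp_eq_integral hf hp0 hp htop]
    exact (enorm_integral_le_lintegral_enorm _).trans
      (h.lintegral_enorm_causalCutoff_mul_zeroExt_le f p)

lemma ae_integrableOn_mul (hc : 0 < c) (hu : Measurable u) (hutop : ∫⁻ s in Ioc 0 T, u s ≠ ∞)
    (hf : MemLp f 2 (stripMeasure T)) : ∀ᵐ p ∂stripMeasure T,
      IntegrableOn (fun q => G p.1 p.2 q.1 q.2 * f q) (univ ×ˢ Ioo 0 p.2) := by
  filter_upwards [ae_restrict_of_ae (ae_duhamelMajorant_ne_top hc hu hutop hf),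
    ae_stripMeasure_mem T] with p htop hp
  exact h.integrableOn_mul_of_duhamelMajorant_ne_top hf.1 hp.2 htop

lemma aestronglyMeasurable_duhamelOp (hc : 0 < c) (hu : Measurable u)
    (hutop : ∫⁻ s in Ioc 0 T, u s ≠ ∞) (hf : MemLp f 2 (stripMeasure T)) :
    AEStronglyMeasurable (duhamelOp G f) (stripMeasure T) := by
  have hprod : AEStronglyMeasurable fun z : (ℝ × ℝ) × (ℝ × ℝ) =>
      causalCutoff T G z.1 z.2 * zeroExt T f z.2 :=
    h.measurable.aestronglyMeasurable.mul (aestronglyMeasurable_zeroExt hf.1).comp_snd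
  refine hprod.integral_prod_right'.restrict.congr ?_
  filter_upwards [ae_restrict_of_ae (ae_duhamelMajorant_ne_top hc hu hutop hf),
    ae_stripMeasure_mem T] with p htop hp
  exact (h.duhamelOp_eq_integral hf.1 hp.1.le hp.2 htop).symm

lemma eLpNorm_top_duhamelOp_le (hf : AEStronglyMeasurable f (stripMeasure T)) {B : ℝ≥0∞}
    (hB : ∀ p, duhamelMajorant c T u f p ≤ B) :
    eLpNorm (duhamelOp G f) ∞ (stripMeasure T) ≤ B := by
  rw [eLpNorm_exponent_top]
  refine eLpNormEssSup_le_of_ae_enorm_bound ?_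
  filter_upwards [ae_stripMeasure_mem T] with p hp
  exact (h.enorm_duhamelOp_le hf hp.1.le hp.2).trans (hB p)

lemma eLpNorm_two_duhamelOp_le (hc : 0 < c) (hu : Measurable u)
    (hf : AEStronglyMeasurable f (stripMeasure T)) :
    eLpNorm (duhamelOp G f) 2 (stripMeasure T) ≤
      (∫⁻ s in Ioc 0 T, u s) * eLpNorm f 2 (stripMeasure T) := by
  refine (ENNReal.pow_le_pow_left_iff two_ne_zero).1 ?_
  calc eLpNorm (duhamelOp G f) 2 (stripMeasure T) ^ 2
      = ∫⁻ p, ‖duhamelOp G f p‖ₑ ^ 2 ∂stripMeasure T := eLpNorm_two_sq _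
    _ ≤ ∫⁻ p, duhamelMajorant c T u f p ^ 2 ∂stripMeasure T := by
        refine lintegral_mono_ae ?_
        filter_upwards [ae_stripMeasure_mem T] with p hp
        exact pow_le_pow_left' (h.enorm_duhamelOp_le hf hp.1.le hp.2) 2
    _ ≤ ∫⁻ p, duhamelMajorant c T u f p ^ 2 := setLIntegral_le_lintegral _ _
    _ ≤ _ := lintegral_duhamelMajorant_sq_le hc hu hf

end Pointwise

end IsDominated

end Duhamel

section PowerProfile

variable {c T k α : ℝ} {G : ℝ → ℝ → ℝ → ℝ → ℝ} {f : ℝ × ℝ → ℝ} {p : ℝ × ℝ}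

lemma lintegral_Ioc_powerProfile (hk : 0 ≤ k) (hα : α < 1) (hT : 0 ≤ T) :
    ∫⁻ s in Ioc 0 T, powerProfile k α s = ENNReal.ofReal (k / (1 - α) * T ^ (1 - α)) := by
  have hα' : 0 < 1 - α := sub_pos.2 hα
  have hint : IntegrableOn (fun s : ℝ => s ^ (-α)) (Ioc 0 T) :=
    (intervalIntegrable_iff_integrableOn_Ioc_of_le hT).1
      (intervalIntegral.intervalIntegrable_rpow' (by linarith))
  have hnonneg : 0 ≤ᵐ[volume.restrict (Ioc 0 T)] fun s : ℝ => s ^ (-α) := by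
    filter_upwards [ae_restrict_mem measurableSet_Ioc] with s hs
      using Real.rpow_nonneg hs.1.le _
  have hintegral : ∫ s in Ioc 0 T, s ^ (-α) = T ^ (1 - α) / (1 - α) := by
    rw [← intervalIntegral.integral_of_le hT, integral_rpow (Or.inl (by linarith)),
      neg_add_eq_sub, Real.zero_rpow hα'.ne', sub_zero]
  simp only [powerProfile]
  rw [lintegral_const_mul _ (by fun_prop), ← ofReal_integral_eq_lintegral_ofReal hint hnonneg,
    hintegral, ← ENNReal.ofReal_mul hk, mul_div_left_comm, mul_comm]

lemma lintegral_Ioc_powerProfile_ne_top (hk : 0 ≤ k) (hα : α < 1) (hT : 0 ≤ T) :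
    ∫⁻ s in Ioc 0 T, powerProfile k α s ≠ ∞ :=
  lintegral_Ioc_powerProfile hk hα hT ▸ ENNReal.ofReal_ne_top

lemma duhamelMajorant_powerProfile_le (hc : 0 < c) (hk : 0 ≤ k) (hα : α < 1 / 4) (hT : 0 ≤ T)
    (hf : AEStronglyMeasurable f (stripMeasure T)) (p : ℝ × ℝ) :
    duhamelMajorant c T (powerProfile k α) f p ≤
      ENNReal.ofReal (k * √(heatKernel c 0 1 / (1 / 2 - 2 * α)) * T ^ (1 / 4 - α)) *
        eLpNorm f 2 (stripMeasure T) := by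
  have hκ : 0 ≤ heatKernel c 0 1 / (1 / 2 - 2 * α) :=
    div_nonneg (heatKernel_nonneg _ _ _) (by linarith)
  have hprofile : ∀ s ∈ Ioc 0 T,
      powerProfile k α s ^ 2 * powerProfile (heatKernel c 0 1) (1 / 2) s =
        powerProfile (k * k * heatKernel c 0 1) (α + α + 1 / 2) s := fun s hs => by
    rw [sq, powerProfile_mul hk _ _ hs.1, powerProfile_mul (mul_nonneg hk hk) _ _ hs.1]
  refine (ENNReal.pow_le_pow_left_iff two_ne_zero).1
    ((sq_duhamelMajorant_le hc (by fun_prop) hf p).trans_eq ?_)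
  rw [setLIntegral_congr_fun measurableSet_Ioc hprofile, lintegral_Ioc_powerProfile
    (mul_nonneg (mul_nonneg hk hk) (heatKernel_nonneg _ _ _)) (by linarith) hT, mul_pow,
    ← ENNReal.ofReal_pow (by positivity), mul_pow, mul_pow, Real.sq_sqrt hκ,
    ← Real.rpow_mul_natCast hT]
  congr 2
  push_cast
  ring_nf

namespace IsDominated

variable (h : IsDominated c T (powerProfile k α) G) (hc : 0 < c) (hk : 0 ≤ k) (hT : 0 ≤ T)

include h hc hk hT

lemma integrableOn_mul_of_powerProfile (hα : α < 1 / 4) (hf : MemLp f 2 (stripMeasure T))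
    (hp : p.2 ≤ T) : IntegrableOn (fun q => G p.1 p.2 q.1 q.2 * f q) (univ ×ˢ Ioo 0 p.2) :=
  h.integrableOn_mul_of_duhamelMajorant_ne_top hf.1 hp <|
    ne_top_of_le_ne_top (ENNReal.mul_ne_top ENNReal.ofReal_ne_top hf.2.ne)
      (duhamelMajorant_powerProfile_le hc hk hα hT hf.1 p)

lemma eLpNorm_top_duhamelOp_le_mul_eLpNorm_two (hα : α < 1 / 4)
    (hf : AEStronglyMeasurable f (stripMeasure T)) :
    eLpNorm (duhamelOp G f) ∞ (stripMeasure T) ≤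
      ENNReal.ofReal (k * √(heatKernel c 0 1 / (1 / 2 - 2 * α)) * T ^ (1 / 4 - α)) *
        eLpNorm f 2 (stripMeasure T) :=
  h.eLpNorm_top_duhamelOp_le hf (duhamelMajorant_powerProfile_le hc hk hα hT hf)

lemma eLpNorm_top_duhamelOp_le_mul_normLinfL2 (hα : α < 3 / 4)
    (hf : AEStronglyMeasurable f (stripMeasure T)) :
    eLpNorm (duhamelOp G f) ∞ (stripMeasure T) ≤
      ENNReal.ofReal (k * √(heatKernel c 0 1) / (3 / 4 - α) * T ^ (3 / 4 - α)) *
        normLinfL2 T f := by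
  refine h.eLpNorm_top_duhamelOp_le hf fun p =>
    (duhamelMajorant_le_mul_normLinfL2 hc (by fun_prop) hf p).trans_eq ?_
  rw [setLIntegral_congr_fun measurableSet_Ioc fun s hs => powerProfile_mul hk _ _ hs.1,
    lintegral_Ioc_powerProfile (by positivity) (by linarith) hT]
  ring_nf

lemma eLpNorm_two_duhamelOp_le_mul_eLpNorm_two (hα : α < 1)
    (hf : AEStronglyMeasurable f (stripMeasure T)) :
    eLpNorm (duhamelOp G f) 2 (stripMeasure T) ≤
      ENNReal.ofReal (k / (1 - α) * T ^ (1 - α)) * eLpNorm f 2 (stripMeasure T) := by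
  rw [← lintegral_Ioc_powerProfile hk hα hT]
  exact h.eLpNorm_two_duhamelOp_le hc (by fun_prop) hf

end IsDominated

end PowerProfile

end ParabolicKernel

open ParabolicKernel in
theorem proposition4p2_general (m M γ T₀ : ℝ) (A α : ℝ≥0) (hm : 0 < m) (hα : 0 < α) (hα1 : α ≤ 1)
    (hT₀ : 0 < T₀) :
    ∃ C : ℝ, ∀ T : ℝ, 0 < T → T ≤ T₀ →
      ∀ a : ℝ × ℝ → ℝ, (∀ p ∈ univ ×ˢ Icc 0 T, a p ∈ Icc m M) →
        HolderOnWith A α a (univ ×ˢ Icc 0 T) →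
        WellDefined a γ T ∧
        ∀ f : ℝ × ℝ → ℝ, MemLp f 2 (stripMeasure T) →
          (∀ x t : ℝ, 0 < t → t ≤ T →
            IntegrableOn (fun q : ℝ × ℝ => Gam a γ x t q.1 q.2 * f q) (univ ×ˢ Ioo 0 t)) ∧
          (∀ᵐ p ∂stripMeasure T,
            IntegrableOn (fun q : ℝ × ℝ => GamX a γ p.1 p.2 q.1 q.2 * f q)
              (univ ×ˢ Ioo 0 p.2)) ∧
          AEStronglyMeasurable (duhamel a γ f) (stripMeasure T) ∧
          AEStronglyMeasurable (duhamelX a γ f) (stripMeasure T) ∧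
          eLpNorm (duhamel a γ f) ∞ (stripMeasure T) ≤
            ENNReal.ofReal (C * T ^ (1 / 4 : ℝ)) * eLpNorm f 2 (stripMeasure T) ∧
          eLpNorm (duhamelX a γ f) ∞ (stripMeasure T) ≤
            ENNReal.ofReal (C * T ^ (1 / 4 : ℝ)) * normLinfL2 T f ∧
          eLpNorm (duhamel a γ f) 2 (stripMeasure T) ≤
            ENNReal.ofReal (C * T) * eLpNorm f 2 (stripMeasure T) ∧
          eLpNorm (duhamelX a γ f) 2 (stripMeasure T) ≤
            ENNReal.ofReal (C * Real.sqrt T) * eLpNorm f 2 (stripMeasure T) := by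
  have hc : 0 < 2 * max m M := by positivity
  obtain ⟨k, hk, hdom⟩ :=
    exists_isDominated_Gam_GamX (A := A) hm (le_max_left m M) hα hα1 γ hT₀
  have hC : 0 ≤ k * √(heatKernel (2 * max m M) 0 1 / (1 / 2)) := by positivity
  have hCX : 0 ≤ k * √(heatKernel (2 * max m M) 0 1) / (1 / 4) := by positivity
  refine ⟨k * √(heatKernel (2 * max m M) 0 1 / (1 / 2)) +
    k * √(heatKernel (2 * max m M) 0 1) / (1 / 4) + 2 * k, fun T hT hTT₀ a ham ha => ?_⟩
  obtain ⟨hwd, hG, hGX⟩ := hdom T hTT₀ a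
    ⟨fun p hp => Icc_subset_Icc_right (le_max_right m M) (ham p hp), ha⟩
  have hint := lintegral_Ioc_powerProfile_ne_top hk.le zero_lt_one hT.le
  have hintX := lintegral_Ioc_powerProfile_ne_top hk.le one_half_lt_one hT.le
  refine ⟨hwd, fun f hf => ⟨fun x t _ ht => hG.integrableOn_mul_of_powerProfile (p := (x, t)) hc
      hk.le hT.le (by norm_num) hf ht,
    hGX.ae_integrableOn_mul hc (by fun_prop) hintX hf,
    hG.aestronglyMeasurable_duhamelOp hc (by fun_prop) hint hf,
    hGX.aestronglyMeasurable_duhamelOp hc (by fun_prop) hintX hf,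
    (hG.eLpNorm_top_duhamelOp_le_mul_eLpNorm_two hc hk.le hT.le (by norm_num) hf.1).trans ?_,
    (hGX.eLpNorm_top_duhamelOp_le_mul_normLinfL2 hc hk.le hT.le (by norm_num) hf.1).trans ?_,
    (hG.eLpNorm_two_duhamelOp_le_mul_eLpNorm_two hc hk.le hT.le one_pos hf.1).trans ?_,
    (hGX.eLpNorm_two_duhamelOp_le_mul_eLpNorm_two hc hk.le hT.le one_half_lt_one hf.1).trans ?_⟩⟩
  · rw [mul_zero, sub_zero, sub_zero]
    gcongr
    linarith
  · rw [show (3 / 4 - 1 / 2 : ℝ) = 1 / 4 by norm_num]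
    gcongr
    linarith
  · rw [sub_zero, div_one, Real.rpow_one]
    gcongr
    linarith
  · rw [sub_half, ← Real.sqrt_eq_rpow]
    gcongr
    linarith

theorem proposition4p2 (m M γ T₀ : ℝ) (L K : ℝ≥0) (hm : 0 < m) (hγ : 0 < γ) (hT₀ : 0 < T₀) :
    ∃ C : ℝ, ∀ T : ℝ, 0 < T → T ≤ T₀ →
      ∀ (g : ℝ → ℝ) (θ : ℝ × ℝ → ℝ),
        LipschitzWith L g → (∀ z, m ≤ g z ∧ g z ≤ M) →
        HolderOnWith K (1 / 2) θ (univ ×ˢ Icc 0 T) →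
        ParabolicKernel.WellDefined (fun p => g (θ p)) γ T ∧
        ∀ f : ℝ × ℝ → ℝ, MemLp f 2 (ParabolicKernel.stripMeasure T) →
          -- the integrals defining `M_f` and `M_{f,x}` converge absolutely
          (∀ x t : ℝ, 0 < t → t ≤ T →
            IntegrableOn (fun q : ℝ × ℝ =>
              ParabolicKernel.Gam (fun p => g (θ p)) γ x t q.1 q.2 * f q)
              (univ ×ˢ Ioo 0 t)) ∧
          (∀ᵐ p ∂(ParabolicKernel.stripMeasure T),
            IntegrableOn (fun q : ℝ × ℝ =>
              ParabolicKernel.GamX (fun p => g (θ p)) γ p.1 p.2 q.1 q.2 * f q)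
              (univ ×ˢ Ioo 0 p.2)) ∧
          AEStronglyMeasurable (ParabolicKernel.duhamel (fun p => g (θ p)) γ f)
            (ParabolicKernel.stripMeasure T) ∧
          AEStronglyMeasurable (ParabolicKernel.duhamelX (fun p => g (θ p)) γ f)
            (ParabolicKernel.stripMeasure T) ∧
          -- the four estimates
          eLpNorm (ParabolicKernel.duhamel (fun p => g (θ p)) γ f) ∞
              (ParabolicKernel.stripMeasure T) ≤
            ENNReal.ofReal (C * T ^ (1 / 4 : ℝ)) *
              eLpNorm f 2 (ParabolicKernel.stripMeasure T) ∧
          eLpNorm (ParabolicKernel.duhamelX (fun p => g (θ p)) γ f) ∞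
              (ParabolicKernel.stripMeasure T) ≤
            ENNReal.ofReal (C * T ^ (1 / 4 : ℝ)) * ParabolicKernel.normLinfL2 T f ∧
          eLpNorm (ParabolicKernel.duhamel (fun p => g (θ p)) γ f) 2
              (ParabolicKernel.stripMeasure T) ≤
            ENNReal.ofReal (C * T) * eLpNorm f 2 (ParabolicKernel.stripMeasure T) ∧
          eLpNorm (ParabolicKernel.duhamelX (fun p => g (θ p)) γ f) 2
              (ParabolicKernel.stripMeasure T) ≤
            ENNReal.ofReal (C * Real.sqrt T) *
              eLpNorm f 2 (ParabolicKernel.stripMeasure T) := by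
  obtain ⟨C, hC⟩ := proposition4p2_general m M γ T₀ (L * K) (1 / 2) hm (by norm_num)
    (by norm_num) hT₀
  exact ⟨C, fun T hT hTT₀ g θ hg hgm hθ => hC T hT hTT₀ _ (fun p _ => hgm (θ p))
    (by simpa [Function.comp_def] using hg.holderWith.comp_holderOnWith hθ)⟩
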